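/- Let $R$ be a commutative noetherian ring, and write $\otimes=\otimes_R$, $(-)^*=\mathrm{Hom}_R(-,R)$. A submodule $K\subseteq M$ is called pure if $K\otimes N\to M\otimes N$ is injective for every $R$-module $N$. A right-right entwining structure $(A,C,\psi)$ consists of an $R$-algebra $A$, an $R$-coalgebra $C$ and an $R$-linear map $\psi:C\otimes A\to A\otimes C$, $c\otimes a\mapsto\sum a_\psi\otimes c^\psi$, such that $$\textstyle\sum(ab)_\psi\otimes c^\psi=\sum a_\psi b_\Psi\otimes c^{\psi\Psi},\quad \sum 1_\psi\otimes c^\psi=1\otimes c,\quad \sum a_\psi\otimes\Delta(c^\psi)=\sum a_{\psi\Psi}\otimes c_1^\Psi\otimes c_2^\psi,\quad \sum\varepsilon(c^\psi)a_\psi=\varepsilon(c)a .$$ Its category $\mathcal M_A^C(\psi)$ of entwined modules has as objects the right $A$-modules $M$ that are also right $C$-comodules with $\varrho(ma)=\sum m_{<0>}a_\psi\otimes m_{<1>}^\psi$, and as morphisms the $A$-linear $C$-colinear maps. The ring $\#_\psi^{op}(C,A)$ is $\mathrm{Hom}_R(C,A)$ with $(f\cdot g)(c)=\sum f(c_2)_\psi\,g(c_1^\psi)$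 and unit $\eta_A\circ\varepsilon_C$; a right module over it is a right $A$-module along $a\mapsto\varepsilon_C(-)a$. The structure satisfies the $\alpha$-condition if for every right $A$-module $M$ the map $\alpha_M^\psi:M\otimes C\to\mathrm{Hom}_R(\#_\psi^{op}(C,A),M)$, $m\otimes c\mapsto[f\mapsto mf(c)]$, is injective; in that case a right $\#_\psi^{op}(C,A)$-module $M$ is called $\#$-rational if for every $m\in M$ the map $f\mapsto mf$ lies in the image of $\alpha_M^\psi$, and $\mathrm{Rat}^C(\mathcal M_{\#_\psi^{op}(C,A)})$ is the full subcategory of $\#$-rational modules. For a module $K$ over a ring, $\sigma[K]$ is the full subcategory of the modules that are isomorphic to a submodule of a quotient of a direct sum of copies of $K$. Let $(A,C,\psi)$ be a right-right entwining structure over $R$. Let $A^\circ=\{f\in A^*\mid AfA\text{ is finitely generated over }R\}$, where $(afb)(x)=f(bxa)$, and suppose that $A$ is an $\alpha$-algebra, i.e. $A^\circ\subseteq R^A$ is pure; then $A^\circ$ is an $R$-coalgebra with $\sum f_1(a)f_2(b)=f(ab)$ and $\varepsilon(f)=f(1)$. Let $\widetilde A\subseteq C^*$ be an $R$-subalgebra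 of the convolution algebra $C^*$ with $\varepsilon_C\in\widetilde A$, and let $\widetilde C\subseteq A^\circ$ be an $R$-subcoalgebra, i.e. a pure $R$-submodule with $\Delta(\widetilde C)\subseteq\widetilde C\otimes\widetilde C$. The canonical map $\widetilde A\otimes\widetilde C\to(C\otimes A)^*$ is then injective. Assume that $\psi^*:(A\otimes C)^*\to(C\otimes A)^*$ maps the image of $\widetilde C\otimes\widetilde A$ in $(A\otimes C)^*$ into the image of $\widetilde A\otimes\widetilde C$ in $(C\otimes A)^*$, and let $\varphi:\widetilde C\otimes\widetilde A\to\widetilde A\otimes\widetilde C$ be the induced $R$-linear map, so that the functional attached to $\varphi(\widetilde f\otimes\widetilde g)$ is $c\otimes a\mapsto\sum\widetilde f(a_\psi)\widetilde g(c^\psi)$. Then $(\widetilde A,\widetilde C,\varphi)$ is a right-right entwining structure which satisfies the $\alpha$-condition. Letting $f\in\#_\varphi^{op}(\widetilde C,\widetilde A)$ act on an entwined module $M$ by $mf=\sum m_{<0>}f(m_{<1>})$ (and leaving maps unchanged) defines an isomorphism of categories $$\mathcal M_{\widetilde A}^{\widetilde C}(\varphi)\simeq\mathrm{Rat}^{\widetilde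 C}(\mathcal M_{\#_\varphi^{op}(\widetilde C,\widetilde A)}),\qquad\text{and}\qquad \mathrm{Rat}^{\widetilde C}(\mathcal M_{\#_\varphi^{op}(\widetilde C,\widetilde A)})=\sigma[(\widetilde A\otimes\widetilde C)_{\#_\varphi^{op}(\widetilde C,\widetilde A)}],$$ where $\widetilde A\otimes\widetilde C$ is the entwined module with $(\widetilde g\otimes\widetilde f)\widetilde h=\sum\widetilde g\,\widetilde h_\varphi\otimes\widetilde f^\varphi$ and coaction $\mathrm{id}\otimes\Delta$, regarded as a right $\#_\varphi^{op}(\widetilde C,\widetilde A)$-module in this way. If moreover $\widetilde C$ is finitely generated projective over $R$, the same assignment is an isomorphism of categories $\mathcal M_{\widetilde A}^{\widetilde C}(\varphi)\simeq\mathcal M_{\#_\varphi^{op}(\widetilde C,\widetilde A)}$ onto the category of all right modules. -/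

import Mathlib

open TensorProduct

universe u

namespace DualEntwining

noncomputable section

/-! ### Pure submodules -/

/-- Purity in the sense of Cohn: `K ⊗ N → M ⊗ N` is injective for every `R`-module `N`. -/
def IsPureSubmodule {R M : Type u} [CommRing R] [AddCommGroup M] [Module R M]
    (K : Submodule R M) : Prop :=
  ∀ (N : Type u) [AddCommGroup N] [Module R N], Function.Injective (K.subtype.rTensor N)

section Separation

variable {R : Type u} [CommRing R]

/-- `g ↦ x ⊗ y ↦ g(y) x`: evaluation of the second tensor factor. -/
def evalRight (X : Type u) {Y : Type u} [AddCommGroup X] [Module R X] [AddCommGroup Y] [Module R Y]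
    (g : Module.Dual R Y) : X ⊗[R] Y →ₗ[R] X :=
  (TensorProduct.rid R X).toLinearMap ∘ₗ g.lTensor X

@[simp] theorem evalRight_tmul {X Y : Type u} [AddCommGroup X] [Module R X] [AddCommGroup Y]
    [Module R Y] (g : Module.Dual R Y) (x : X) (y : Y) :
    evalRight X g (x ⊗ₜ y) = g y • x := by
  simp [evalRight]

theorem evalRight_piProj {X W : Type u} [AddCommGroup X] [Module R X] [IsNoetherianRing R]
    (t : X ⊗[R] (W → R)) (h : ∀ w, evalRight X (LinearMap.proj w) t = 0) : t = 0 := by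
  obtain ⟨n, x, g, rfl⟩ := TensorProduct.exists_sum_tmul_eq t
  let L : (Fin n → R) →ₗ[R] X := Fintype.linearCombination R x
  obtain ⟨m, k, hk⟩ := Submodule.fg_iff_exists_fin_generating_family.1
    (IsNoetherian.noetherian (LinearMap.ker L))
  have hg : ∀ w, ∃ c : Fin m → R, ∑ j, c j • k j = fun i => g i w := by
    intro w
    have : (fun i => g i w) ∈ LinearMap.ker L := by
      rw [LinearMap.mem_ker, ← h w]
      simp [L, Fintype.linearCombination_apply]
    rw [← hk] at this
    exact (Submodule.mem_span_range_iff_exists_fun R).1 this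
  choose c hc using hg
  have hgi : ∀ i, g i = ∑ j, k j i • fun w => c w j := by
    intro i
    ext w
    have := congrFun (hc w) i
    simp only [Finset.sum_apply, Pi.smul_apply, smul_eq_mul] at this ⊢
    rw [← this]
    exact Finset.sum_congr rfl fun j _ => mul_comm _ _
  have hkj : ∀ j, ∑ i, k j i • x i = 0 := by
    intro j
    have : k j ∈ LinearMap.ker L := hk ▸ Submodule.subset_span ⟨j, rfl⟩
    simpa [L, Fintype.linearCombination_apply] using this
  simp_rw [hgi, TensorProduct.tmul_sum, TensorProduct.tmul_smul]
  rw [Finset.sum_comm]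
  simp_rw [TensorProduct.smul_tmul', ← TensorProduct.sum_tmul, hkj, TensorProduct.zero_tmul]
  simp

/-- A map `j : Y → R^W` is universally injective. -/
def IsPureMap {Y W : Type u} [AddCommGroup Y] [Module R Y] (j : Y →ₗ[R] (W → R)) : Prop :=
  ∀ (N : Type u) [AddCommGroup N] [Module R N], Function.Injective (j.rTensor N)

theorem IsPureMap.lTensor {Y Z : Type u} [AddCommGroup Y] [Module R Y] [AddCommGroup Z]
    [Module R Z] (j : Y →ₗ[R] Z) (N : Type u) [AddCommGroup N] [Module R N]
    (hj : Function.Injective (j.rTensor N)) : Function.Injective (j.lTensor N) := by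
  rw [← LinearMap.comm_comp_rTensor_comp_comm_eq]
  simpa using hj

theorem IsPureMap.eq_zero [IsNoetherianRing R] {X Y W : Type u} [AddCommGroup X] [Module R X]
    [AddCommGroup Y] [Module R Y] {j : Y →ₗ[R] (W → R)} (hj : IsPureMap j) (t : X ⊗[R] Y)
    (h : ∀ w, evalRight X (LinearMap.proj w ∘ₗ j) t = 0) : t = 0 := by
  refine (injective_iff_map_eq_zero _).1 (IsPureMap.lTensor j X (hj X)) t ?_
  refine evalRight_piProj _ fun w => ?_
  rw [← h w]
  simp [evalRight, LinearMap.lTensor_comp]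

/-- The canonical map `X ⊗ Y → (V ⊗ W)^*` attached to `X → V^*` and `Y → W^*`,
`(f ⊗ g)(v ⊗ w) = f(v) g(w)`. -/
def pairTensor {X Y V W : Type u} [AddCommGroup X] [Module R X] [AddCommGroup Y] [Module R Y]
    [AddCommGroup V] [Module R V] [AddCommGroup W] [Module R W]
    (i : X →ₗ[R] Module.Dual R V) (j : Y →ₗ[R] Module.Dual R W) :
    X ⊗[R] Y →ₗ[R] Module.Dual R (V ⊗[R] W) :=
  TensorProduct.dualDistrib R V W ∘ₗ TensorProduct.map i j

@[simp] theorem pairTensor_tmul {X Y V W : Type u} [AddCommGroup X] [Module R X] [AddCommGroup Y]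
    [Module R Y] [AddCommGroup V] [Module R V] [AddCommGroup W] [Module R W]
    (i : X →ₗ[R] Module.Dual R V) (j : Y →ₗ[R] Module.Dual R W) (x : X) (y : Y) (v : V) (w : W) :
    pairTensor i j (x ⊗ₜ y) (v ⊗ₜ w) = i x v * j y w := by
  simp [pairTensor]

theorem pairTensor_eq {X Y V W : Type u} [AddCommGroup X] [Module R X] [AddCommGroup Y]
    [Module R Y] [AddCommGroup V] [Module R V] [AddCommGroup W] [Module R W]
    (i : X →ₗ[R] Module.Dual R V) (j : Y →ₗ[R] Module.Dual R W) (t : X ⊗[R] Y) (v : V) (w : W) :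
    pairTensor i j t (v ⊗ₜ w) = i (evalRight X (LinearMap.applyₗ w ∘ₗ j) t) v := by
  induction t with
  | zero => simp
  | tmul x y => simp [mul_comm]
  | add s t hs ht => simp [hs, ht]

theorem pairTensor_injective [IsNoetherianRing R] {X Y V W : Type u} [AddCommGroup X] [Module R X]
    [AddCommGroup Y] [Module R Y] [AddCommGroup V] [Module R V] [AddCommGroup W] [Module R W]
    (i : X →ₗ[R] Module.Dual R V) (j : Y →ₗ[R] Module.Dual R W) (hi : Function.Injective i)
    (hj : IsPureMap (LinearMap.ltoFun R W R R ∘ₗ j)) : Function.Injective (pairTensor i j) := by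
  rw [injective_iff_map_eq_zero]
  intro t ht
  refine hj.eq_zero t fun w => ?_
  apply (injective_iff_map_eq_zero i).1 hi
  ext v
  have := pairTensor_eq i j t v w
  rw [ht] at this
  exact this.symm

/-- If `ι : Y → Z` is injective and the image of `g : X → Z` lies in that of `ι`, the unique
linear map `X → Y` through which `g` factors. -/
def factorThrough {X Y Z : Type u} [AddCommGroup X] [Module R X] [AddCommGroup Y] [Module R Y]
    [AddCommGroup Z] [Module R Z] (ι : Y →ₗ[R] Z) (hι : Function.Injective ι) (g : X →ₗ[R] Z)
    (hg : ∀ x, g x ∈ LinearMap.range ι) : X →ₗ[R] Y :=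
  (LinearEquiv.ofInjective ι hι).symm.toLinearMap ∘ₗ g.codRestrict (LinearMap.range ι) hg

@[simp] theorem factorThrough_spec {X Y Z : Type u} [AddCommGroup X] [Module R X] [AddCommGroup Y]
    [Module R Y] [AddCommGroup Z] [Module R Z] (ι : Y →ₗ[R] Z) (hι : Function.Injective ι)
    (g : X →ₗ[R] Z) (hg : ∀ x, g x ∈ LinearMap.range ι) (x : X) :
    ι (factorThrough ι hι g hg x) = g x := by
  have := LinearEquiv.apply_symm_apply (LinearEquiv.ofInjective ι hι)
    (g.codRestrict (LinearMap.range ι) hg x)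
  exact congrArg Subtype.val this

end Separation

/-! ### The finite dual of an algebra over a noetherian ring -/

section FiniteDual

variable (R A : Type u) [CommRing R] [Ring A] [Algebra R A]

/-- `A f A`, the sub-bimodule of `A^*` generated by `f`, for `(a f b)(x) = f(b x a)`. -/
def bimoduleSpan (f : Module.Dual R A) : Submodule R (Module.Dual R A) :=
  Submodule.span R (Set.range fun p : A × A =>
    f ∘ₗ LinearMap.mulLeft R p.2 ∘ₗ LinearMap.mulRight R p.1)

theorem mem_bimoduleSpan (f : Module.Dual R A) (a b : A) :
    f ∘ₗ LinearMap.mulLeft R b ∘ₗ LinearMap.mulRight R a ∈ bimoduleSpan R A f :=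
  Submodule.subset_span ⟨(a, b), rfl⟩

theorem fg_of_le_fg [IsNoetherianRing R] {M : Type u} [AddCommGroup M] [Module R M]
    {N P : Submodule R M} (h : N ≤ P) (hP : P.FG) : N.FG :=
  isNoetherian_submodule.1 (isNoetherian_of_fg_of_noetherian P hP) N h

/-- The finite dual `A° = {f ∈ A^* | A f A is finitely generated over R}`. -/
def finiteDual [IsNoetherianRing R] : Submodule R (Module.Dual R A) where
  carrier := {f | (bimoduleSpan R A f).FG}
  zero_mem' := by
    have : bimoduleSpan R A 0 = ⊥ := by
      simp [bimoduleSpan]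
    simpa [this] using Submodule.fg_bot
  add_mem' := by
    intro f g hf hg
    refine fg_of_le_fg R (Submodule.span_le.2 ?_) (Submodule.FG.sup hf hg)
    rintro _ ⟨p, rfl⟩
    exact Submodule.add_mem_sup (mem_bimoduleSpan R A f p.1 p.2) (mem_bimoduleSpan R A g p.1 p.2)
  smul_mem' := by
    intro r f hf
    refine fg_of_le_fg R (Submodule.span_le.2 ?_) hf
    rintro _ ⟨p, rfl⟩
    exact Submodule.smul_mem _ r (mem_bimoduleSpan R A f p.1 p.2)

/-- An algebra over a noetherian ring is an `α`-algebra if `A° ⊆ R^A` is pure. -/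
class IsAlphaAlgebra [IsNoetherianRing R] : Prop where
  pure : IsPureSubmodule ((finiteDual R A).map (LinearMap.ltoFun R A R R))

variable [IsNoetherianRing R]

theorem mem_finiteDual_bimodule {f : Module.Dual R A} (hf : f ∈ finiteDual R A) (a b : A) :
    f ∘ₗ LinearMap.mulLeft R b ∘ₗ LinearMap.mulRight R a ∈ finiteDual R A := by
  refine fg_of_le_fg R (Submodule.span_le.2 ?_) hf
  rintro _ ⟨p, rfl⟩
  refine Submodule.subset_span ⟨(p.1 * a, b * p.2), ?_⟩
  ext x
  simp [mul_assoc]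

/-- The finite dual as a type. -/
def FiniteDual : Type u := finiteDual R A

instance : AddCommGroup (FiniteDual R A) := inferInstanceAs (AddCommGroup (finiteDual R A))

instance : Module R (FiniteDual R A) := inferInstanceAs (Module R (finiteDual R A))

/-- The inclusion `A° → A^*`. -/
def FiniteDual.incl : FiniteDual R A →ₗ[R] Module.Dual R A := (finiteDual R A).subtype

theorem FiniteDual.incl_injective : Function.Injective (FiniteDual.incl R A) :=
  Subtype.val_injective

/-- The functional `x ↦ f(b x a)`. -/
def FiniteDual.bimod (f : FiniteDual R A) (a b : A) : FiniteDual R A :=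
  ⟨FiniteDual.incl R A f ∘ₗ LinearMap.mulLeft R b ∘ₗ LinearMap.mulRight R a,
    mem_finiteDual_bimodule R A f.2 a b⟩

@[simp] theorem FiniteDual.incl_bimod (f : FiniteDual R A) (a b x : A) :
    FiniteDual.incl R A (f.bimod R A a b) x = FiniteDual.incl R A f (b * (x * a)) := rfl

theorem finiteDual_isPureMap [IsAlphaAlgebra R A] :
    IsPureMap (LinearMap.ltoFun R A R R ∘ₗ FiniteDual.incl R A) := by
  intro N _ _
  have hinj : Function.Injective (LinearMap.ltoFun R A R R) := DFunLike.coe_injective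
  let e : FiniteDual R A ≃ₗ[R] (finiteDual R A).map (LinearMap.ltoFun R A R R) :=
    (finiteDual R A).equivMapOfInjective _ hinj
  have he : LinearMap.ltoFun R A R R ∘ₗ FiniteDual.incl R A =
      ((finiteDual R A).map (LinearMap.ltoFun R A R R)).subtype ∘ₗ e.toLinearMap := by
    ext x; rfl
  rw [he, LinearMap.rTensor_comp, LinearMap.coe_comp]
  exact (IsAlphaAlgebra.pure N).comp (LinearEquiv.rTensor N e).injective

/-- The canonical embedding `A° ⊗ A° → (A ⊗ A)^*`. -/
def finiteDualPair : FiniteDual R A ⊗[R] FiniteDual R A →ₗ[R] Module.Dual R (A ⊗[R] A) :=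
  pairTensor (FiniteDual.incl R A) (FiniteDual.incl R A)

theorem finiteDualPair_injective [IsAlphaAlgebra R A] :
    Function.Injective (finiteDualPair R A) :=
  pairTensor_injective _ _ (FiniteDual.incl_injective R A) (finiteDual_isPureMap R A)

theorem finiteDual_comul_exists [IsAlphaAlgebra R A] (f : FiniteDual R A) :
    ((LinearMap.mul' R A).dualMap ∘ₗ FiniteDual.incl R A) f ∈
      LinearMap.range (finiteDualPair R A) := by
  let j := LinearMap.ltoFun R A R R ∘ₗ FiniteDual.incl R A
  let F : A → FiniteDual R A := fun b => f.bimod R A b 1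
  have hfg : (Submodule.span R (Set.range F)).FG := by
    refine Submodule.fg_of_fg_map_injective (FiniteDual.incl R A) (FiniteDual.incl_injective R A) ?_
    refine fg_of_le_fg R ?_ f.2
    rw [Submodule.map_span, Submodule.span_le]
    rintro _ ⟨_, ⟨b, rfl⟩, rfl⟩
    exact mem_bimoduleSpan R A (FiniteDual.incl R A f) b 1
  obtain ⟨n, m, hm⟩ := Submodule.fg_iff_exists_fin_generating_family.1 hfg
  have hF : ∀ b, ∃ c : Fin n → R, ∑ k, c k • m k = F b := fun b =>
    (Submodule.mem_span_range_iff_exists_fun R).1 (hm ▸ Submodule.subset_span ⟨b, rfl⟩)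
  choose g hg using hF
  have hgab : ∀ a b, ∑ k, g b k * FiniteDual.incl R A (m k) a = FiniteDual.incl R A f (a * b) := by
    intro a b
    have := congrArg (fun h : FiniteDual R A => FiniteDual.incl R A h a) (hg b)
    simp only [map_sum, map_smul, LinearMap.sum_apply, LinearMap.smul_apply, smul_eq_mul] at this
    simpa [F] using this
  let u : FiniteDual R A ⊗[R] (A → R) := ∑ k, m k ⊗ₜ fun b => g b k
  let q := (LinearMap.range j).mkQ
  have hu : q.lTensor (FiniteDual R A) u = 0 := by
    refine (injective_iff_map_eq_zero _).1 (finiteDual_isPureMap R A _) _ ?_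
    refine (TensorProduct.comm R _ _).injective ?_
    rw [map_zero]
    refine evalRight_piProj _ fun a => ?_
    have : q (j (f.bimod R A 1 a)) = 0 :=
      (Submodule.Quotient.mk_eq_zero _).2 ⟨_, rfl⟩
    rw [← this]
    simp only [u, map_sum, LinearMap.lTensor_tmul, LinearMap.rTensor_tmul,
      TensorProduct.comm_tmul, evalRight_tmul, ← map_smul]
    rw [← map_sum]
    congr 1
    ext b
    simpa [j, mul_comm] using hgab a b
  obtain ⟨t, ht⟩ := (lTensor_exact (FiniteDual R A) (f := j) (g := q)
    (LinearMap.exact_map_mkQ_range j) (Submodule.mkQ_surjective _) u).1 hu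
  refine ⟨t, ?_⟩
  ext a b
  have h1 : ∀ b, evalRight (FiniteDual R A) (LinearMap.applyₗ b ∘ₗ FiniteDual.incl R A) t =
      F b := by
    intro b
    have : evalRight (FiniteDual R A) (LinearMap.proj b) (j.lTensor (FiniteDual R A) t) = F b := by
      rw [ht, ← hg b]
      simp [u]
    rw [← this]
    simp only [evalRight, LinearMap.comp_apply, ← LinearMap.lTensor_comp_apply]
    rfl
  have := pairTensor_eq (FiniteDual.incl R A) (FiniteDual.incl R A) t a b
  rw [h1] at this
  simpa [F, finiteDualPair] using this

/-- The comultiplication of `A°`: the dual of the multiplication of `A`,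
`∑ f₁(a) f₂(b) = f(ab)`. -/
def finiteDualComul [IsAlphaAlgebra R A] :
    FiniteDual R A →ₗ[R] FiniteDual R A ⊗[R] FiniteDual R A :=
  factorThrough (finiteDualPair R A) (finiteDualPair_injective R A)
    ((LinearMap.mul' R A).dualMap ∘ₗ FiniteDual.incl R A) (finiteDual_comul_exists R A)

theorem finiteDualPair_comul [IsAlphaAlgebra R A] (f : FiniteDual R A) (a b : A) :
    finiteDualPair R A (finiteDualComul R A f) (a ⊗ₜ b) = FiniteDual.incl R A f (a * b) := by
  simp [finiteDualComul]

/-- Evaluation at `1`. -/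
def finiteDualCounit : FiniteDual R A →ₗ[R] R :=
  LinearMap.applyₗ 1 ∘ₗ FiniteDual.incl R A

theorem finiteDual_eq_zero [IsAlphaAlgebra R A] {X : Type u} [AddCommGroup X] [Module R X]
    (t : X ⊗[R] FiniteDual R A)
    (h : ∀ a, evalRight X (LinearMap.applyₗ a ∘ₗ FiniteDual.incl R A) t = 0) : t = 0 :=
  (finiteDual_isPureMap R A).eq_zero t h

/-- `A°` is a coalgebra when `A` is an `α`-algebra over a noetherian ring. -/
instance finiteDualCoalgebra [IsAlphaAlgebra R A] : Coalgebra R (FiniteDual R A) where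
  comul := finiteDualComul R A
  counit := finiteDualCounit R A
  coassoc := by
    ext1 f
    apply (TensorProduct.assoc R _ _ _).symm.injective
    rw [← sub_eq_zero]
    refine finiteDual_eq_zero R A _ fun c => ?_
    apply finiteDualPair_injective R A
    ext a b
    have hB : ∀ (x : FiniteDual R A) (t : FiniteDual R A ⊗[R] FiniteDual R A),
        finiteDualPair R A (evalRight _ (LinearMap.applyₗ c ∘ₗ FiniteDual.incl R A)
          ((TensorProduct.assoc R _ _ _).symm (x ⊗ₜ t))) (a ⊗ₜ b) =
        FiniteDual.incl R A x a * finiteDualPair R A t (b ⊗ₜ c) := by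
      intro x t
      induction t with
      | zero => simp
      | tmul y z => simp [finiteDualPair]; ring
      | add s t hs ht => simp [tmul_add, mul_add, hs, ht]
    have h1 : ∀ s : FiniteDual R A ⊗[R] FiniteDual R A,
        finiteDualPair R A (evalRight _ (LinearMap.applyₗ c ∘ₗ FiniteDual.incl R A)
          ((finiteDualComul R A).rTensor _ s)) (a ⊗ₜ b) =
        finiteDualPair R A s ((a * b) ⊗ₜ c) := by
      intro s
      induction s with
      | zero => simp
      | tmul y z => simp [finiteDualPair_comul]; simp [finiteDualPair, mul_comm]
      | add s t hs ht => simp [hs, ht]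
    have h2 : ∀ s : FiniteDual R A ⊗[R] FiniteDual R A,
        finiteDualPair R A (evalRight _ (LinearMap.applyₗ c ∘ₗ FiniteDual.incl R A)
          ((TensorProduct.assoc R _ _ _).symm ((finiteDualComul R A).lTensor _ s))) (a ⊗ₜ b) =
        finiteDualPair R A s (a ⊗ₜ (b * c)) := by
      intro s
      induction s with
      | zero => simp
      | tmul y z => simp [hB, finiteDualPair_comul]; simp [finiteDualPair]
      | add s t hs ht => simp [hs, ht]
    simp [h1, h2, finiteDualPair_comul, mul_assoc]
  rTensor_counit_comp_comul := by
    ext1 f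
    rw [← sub_eq_zero]
    refine finiteDual_eq_zero R A _ fun c => ?_
    have h := finiteDualPair_comul R A f 1 c
    have : ∀ t : FiniteDual R A ⊗[R] FiniteDual R A, 
       evalRight R (LinearMap.applyₗ c ∘ₗ FiniteDual.incl R A) 
         ((finiteDualCounit R A).rTensor _ t) = finiteDualPair R A t (1 ⊗ₜ c) := by
      intro t
      induction t with
      | zero => simp
      | tmul x y => simp [finiteDualPair, finiteDualCounit, mul_comm]
      | add s t hs ht => simp [hs, ht]
    simp [this, h]
  lTensor_counit_comp_comul := by
    ext1 f
    apply (TensorProduct.rid R _).injective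
    apply FiniteDual.incl_injective R A
    ext c
    have h := finiteDualPair_comul R A f c 1
    have : ∀ t : FiniteDual R A ⊗[R] FiniteDual R A, 
       FiniteDual.incl R A (TensorProduct.rid R _ ((finiteDualCounit R A).lTensor _ t)) c 
         = finiteDualPair R A t (c ⊗ₜ 1) := by
      intro t
      induction t with
      | zero => simp
      | tmul x y => simp [finiteDualPair, finiteDualCounit, mul_comm]
      | add s t hs ht => simp [hs, ht]
    simp [this, h]

end FiniteDual

/-! ### Subcoalgebras -/

/-- A subcoalgebra of a coalgebra over a commutative ring: a pure submodule `D ⊆ C`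
(so that `D ⊗ D ⊆ C ⊗ C`) with `Δ(D) ⊆ D ⊗ D`. -/
structure Subcoalgebra (R C : Type u) [CommRing R] [AddCommGroup C] [Module R C]
    [Coalgebra R C] where
  toSubmodule : Submodule R C
  pure : IsPureSubmodule toSubmodule
  comul_mem : ∀ d ∈ toSubmodule, (CoalgebraStruct.comul d : C ⊗[R] C) ∈
    LinearMap.range (TensorProduct.map toSubmodule.subtype toSubmodule.subtype)

namespace Subcoalgebra

variable {R C : Type u} [CommRing R] [AddCommGroup C] [Module R C] [Coalgebra R C]

/-- The underlying type of a subcoalgebra. -/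
def Carrier (D : Subcoalgebra R C) : Type u := D.toSubmodule

instance : CoeSort (Subcoalgebra R C) (Type u) := ⟨Carrier⟩

variable (D : Subcoalgebra R C)

instance : AddCommGroup D := inferInstanceAs (AddCommGroup D.toSubmodule)

instance : Module R D := inferInstanceAs (Module R D.toSubmodule)

/-- The inclusion of a subcoalgebra. -/
def incl : D →ₗ[R] C := D.toSubmodule.subtype

theorem incl_injective : Function.Injective D.incl := Subtype.val_injective

theorem rTensor_incl_injective (N : Type u) [AddCommGroup N] [Module R N] :
    Function.Injective (D.incl.rTensor N) := D.pure N

theorem lTensor_incl_injective (N : Type u) [AddCommGroup N] [Module R N] :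
    Function.Injective (D.incl.lTensor N) := IsPureMap.lTensor _ _ (D.rTensor_incl_injective N)

theorem lTensor_lTensor_incl_injective (M N : Type u) [AddCommGroup M] [Module R M]
    [AddCommGroup N] [Module R N] :
    Function.Injective ((D.incl.lTensor N).lTensor M) := by
  have h : (D.incl.lTensor N).lTensor M = (TensorProduct.assoc R M N C).toLinearMap ∘ₗ
      D.incl.lTensor (M ⊗[R] N) ∘ₗ (TensorProduct.assoc R M N D).symm.toLinearMap := by
    ext; simp
  rw [h]
  simpa using D.lTensor_incl_injective (M ⊗[R] N)

theorem lTensor_rTensor_incl_injective (M N : Type u) [AddCommGroup M] [Module R M]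
    [AddCommGroup N] [Module R N] :
    Function.Injective ((D.incl.rTensor N).lTensor M) := by
  have h : (D.incl.rTensor N).lTensor M =
      ((TensorProduct.comm R N C).lTensor M).toLinearMap ∘ₗ
      (D.incl.lTensor N).lTensor M ∘ₗ ((TensorProduct.comm R D N).lTensor M).toLinearMap := by
    ext; simp
  rw [h, LinearMap.coe_comp, LinearMap.coe_comp]
  exact (LinearEquiv.injective _).comp
    ((D.lTensor_lTensor_incl_injective M N).comp (LinearEquiv.injective _))

theorem map_incl_injective : Function.Injective (TensorProduct.map D.incl D.incl) := by
  rw [← LinearMap.lTensor_comp_rTensor, LinearMap.coe_comp]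
  exact (D.lTensor_incl_injective C).comp (D.rTensor_incl_injective D)

/-- The restricted comultiplication. -/
def comul : D →ₗ[R] D ⊗[R] D :=
  factorThrough (TensorProduct.map D.incl D.incl) D.map_incl_injective
    (CoalgebraStruct.comul ∘ₗ D.incl) (fun d => D.comul_mem (D.incl d) d.2)

theorem map_incl_comul (d : D) :
    TensorProduct.map D.incl D.incl (D.comul d) = CoalgebraStruct.comul (D.incl d) :=
  factorThrough_spec _ D.map_incl_injective _ _ d

/-- A subcoalgebra is a coalgebra, with the structure induced from the ambient one. -/
instance : Coalgebra R D where
  comul := D.comul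
  counit := CoalgebraStruct.counit ∘ₗ D.incl
  coassoc := by
    ext1 d
    have hinj : Function.Injective
        (TensorProduct.map D.incl (TensorProduct.map D.incl D.incl)) := by
      rw [← LinearMap.lTensor_comp_rTensor, LinearMap.coe_comp]
      refine Function.Injective.comp ?_ (D.rTensor_incl_injective _)
      rw [← LinearMap.lTensor_comp_rTensor, LinearMap.lTensor_comp, LinearMap.coe_comp]
      refine Function.Injective.comp ?_ ?_
      · exact D.lTensor_lTensor_incl_injective C C
      · exact D.lTensor_rTensor_incl_injective C D
    apply hinj
    have h1 : ∀ s : D ⊗[R] D, TensorProduct.map D.incl (TensorProduct.map D.incl D.incl)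
        (TensorProduct.assoc R _ _ _ (D.comul.rTensor _ s)) =
        TensorProduct.assoc R _ _ _ ((CoalgebraStruct.comul (R := R) (A := C)).rTensor C
          (TensorProduct.map D.incl D.incl s)) := by
      intro s
      rw [TensorProduct.map_map_assoc]
      congr 1
      induction s with
      | zero => simp
      | tmul x y => simp [map_incl_comul]
      | add s t hs ht => simp only [map_add, hs, ht]
    have h2 : ∀ s : D ⊗[R] D, TensorProduct.map D.incl (TensorProduct.map D.incl D.incl)
        (D.comul.lTensor _ s) = (CoalgebraStruct.comul (R := R) (A := C)).lTensor C
          (TensorProduct.map D.incl D.incl s) := by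
      intro s
      induction s with
      | zero => simp
      | tmul x y => simp [map_incl_comul]
      | add s t hs ht => simp only [map_add, hs, ht]
    simp only [LinearMap.comp_apply, LinearEquiv.coe_coe]
    rw [h1, h2, map_incl_comul]
    exact Coalgebra.coassoc_apply _
  rTensor_counit_comp_comul := by
    ext1 d
    apply D.lTensor_incl_injective R
    have : ∀ s : D ⊗[R] D, D.incl.lTensor R ((CoalgebraStruct.counit ∘ₗ D.incl).rTensor _ s) =
        (CoalgebraStruct.counit (R := R) (A := C)).rTensor C (TensorProduct.map D.incl D.incl s) := by
      intro s
      induction s with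
      | zero => simp
      | tmul x y => simp
      | add s t hs ht => simp only [map_add, hs, ht]
    simp [this, map_incl_comul]
  lTensor_counit_comp_comul := by
    ext1 d
    apply D.rTensor_incl_injective R
    have : ∀ s : D ⊗[R] D, D.incl.rTensor R ((CoalgebraStruct.counit ∘ₗ D.incl).lTensor _ s) =
        (CoalgebraStruct.counit (R := R) (A := C)).lTensor C (TensorProduct.map D.incl D.incl s) := by
      intro s
      induction s with
      | zero => simp
      | tmul x y => simp
      | add s t hs ht => simp only [map_add, hs, ht]
    simp [this, map_incl_comul]

end Subcoalgebra

/-! ### Entwining structures and entwined modules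

Right `A`-modules are modules over `Aᵐᵒᵖ`: `m a` is `MulOpposite.op a • m`. -/

section Entwining

open MulOpposite CategoryTheory

/-- The right action of `A` on `M` as a linear map `M ⊗ A → M`. -/
def rightAct (R A M : Type u) [CommRing R] [Ring A] [Algebra R A] [AddCommGroup M] [Module R M]
    [Module Aᵐᵒᵖ M] [IsScalarTower R Aᵐᵒᵖ M] : M ⊗[R] A →ₗ[R] M :=
  TensorProduct.lift (LinearMap.mk₂ R (fun m a => op a • m)
    (fun m n a => smul_add _ m n) (fun r m a => smul_comm _ r m)
    (fun m a b => by rw [MulOpposite.op_add, add_smul])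
    (fun r m a => by rw [MulOpposite.op_smul, smul_assoc]))

@[simp] theorem rightAct_tmul (R A M : Type u) [CommRing R] [Ring A] [Algebra R A]
    [AddCommGroup M] [Module R M] [Module Aᵐᵒᵖ M] [IsScalarTower R Aᵐᵒᵖ M] (m : M) (a : A) :
    rightAct R A M (m ⊗ₜ a) = op a • m := by
  simp [rightAct]

/-- A right-right entwining structure `(A, C, ψ)` over `R`, `ψ (c ⊗ a) = ∑ a_ψ ⊗ c^ψ`. -/
structure EntwiningStructure (R A C : Type u) [CommRing R] [Ring A] [Algebra R A]
    [AddCommGroup C] [Module R C] [Coalgebra R C] where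
  /-- the entwining map `ψ` -/
  ψ : C ⊗[R] A →ₗ[R] A ⊗[R] C
  /-- `∑ (ab)_ψ ⊗ c^ψ = ∑ a_ψ b_Ψ ⊗ c^{ψΨ}` -/
  ψ_mul : ∀ (c : C) (a b : A), ψ (c ⊗ₜ (a * b)) =
    (LinearMap.mul' R A).rTensor C ((TensorProduct.assoc R A A C).symm
      (ψ.lTensor A (TensorProduct.assoc R A C A (ψ (c ⊗ₜ a) ⊗ₜ b))))
  /-- `∑ 1_ψ ⊗ c^ψ = 1 ⊗ c` -/
  ψ_one : ∀ c : C, ψ (c ⊗ₜ 1) = 1 ⊗ₜ c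
  /-- `∑ a_ψ ⊗ Δ(c^ψ) = ∑ a_{ψΨ} ⊗ c₁^Ψ ⊗ c₂^ψ` -/
  ψ_comul : ∀ (c : C) (a : A), CoalgebraStruct.comul.lTensor A (ψ (c ⊗ₜ a)) =
    TensorProduct.assoc R A C C (ψ.rTensor C ((TensorProduct.assoc R C A C).symm
      (ψ.lTensor C (TensorProduct.assoc R C C A (CoalgebraStruct.comul c ⊗ₜ a)))))
  /-- `∑ ε(c^ψ) a_ψ = ε(c) a` -/
  ψ_counit : ∀ (c : C) (a : A),
    TensorProduct.rid R A (CoalgebraStruct.counit.lTensor A (ψ (c ⊗ₜ a))) =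
      (CoalgebraStruct.counit c : R) • a

variable {R A C : Type u} [CommRing R] [Ring A] [Algebra R A] [AddCommGroup C] [Module R C]
  [Coalgebra R C] (E : EntwiningStructure R A C)

/-- For a right `A`-module `M`, the map `(m ⊗ c) ⊗ a ↦ ∑ m a_ψ ⊗ c^ψ`. -/
def twist (M : Type u) [AddCommGroup M] [Module R M] [Module Aᵐᵒᵖ M] [IsScalarTower R Aᵐᵒᵖ M] :
    (M ⊗[R] C) ⊗[R] A →ₗ[R] M ⊗[R] C :=
  (rightAct R A M).rTensor C ∘ₗ (TensorProduct.assoc R M A C).symm.toLinearMap ∘ₗ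
    E.ψ.lTensor M ∘ₗ (TensorProduct.assoc R M C A).toLinearMap

/-- A right-right entwined module: a right `A`-module and right `C`-comodule `M` with
`ϱ(ma) = ∑ m₀ a_ψ ⊗ m₁^ψ`. -/
structure EntwinedModule where
  carrier : Type u
  [addCommGroup : AddCommGroup carrier]
  [module : Module R carrier]
  [rightModule : Module Aᵐᵒᵖ carrier]
  [isScalarTower : IsScalarTower R Aᵐᵒᵖ carrier]
  /-- the coaction `ϱ` -/
  coact : carrier →ₗ[R] carrier ⊗[R] C
  coact_coassoc : ∀ m, TensorProduct.assoc R carrier C C (coact.rTensor C (coact m)) =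
    CoalgebraStruct.comul.lTensor carrier (coact m)
  coact_counit : ∀ m,
    TensorProduct.rid R carrier (CoalgebraStruct.counit.lTensor carrier (coact m)) = m
  coact_smul : ∀ (m : carrier) (a : A), coact (op a • m) = twist E carrier (coact m ⊗ₜ a)

namespace EntwinedModule

attribute [instance] addCommGroup module rightModule isScalarTower

variable {E}

instance : CoeSort (EntwinedModule E) (Type u) := ⟨carrier⟩

/-- `A`-linear `C`-colinear maps. -/
@[ext]
structure Hom (M N : EntwinedModule E) where
  toLinearMap : M →ₗ[R] N
  map_smul : ∀ (a : A) (m : M), toLinearMap (op a • m) = op a • toLinearMap m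
  map_coact : ∀ m : M, N.coact (toLinearMap m) = toLinearMap.rTensor C (M.coact m)

/-- The category `M_A^C(ψ)` of entwined modules. -/
instance : CategoryTheory.Category (EntwinedModule E) where
  Hom := Hom
  id M := ⟨LinearMap.id, fun _ _ => rfl, fun m => by simp⟩
  comp f g := ⟨g.toLinearMap ∘ₗ f.toLinearMap, fun a m => by simp [f.map_smul, g.map_smul],
    fun m => by simp [f.map_coact, g.map_coact, LinearMap.rTensor_comp]⟩

/-- The endomorphism `m ↦ ∑ m₀ f(m₁)` attached to `f ∈ Hom_R(C, A)`. -/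
def actBy (M : EntwinedModule E) (f : C →ₗ[R] A) : M →ₗ[R] M :=
  rightAct R A M ∘ₗ f.lTensor M ∘ₗ M.coact

end EntwinedModule

section Induced

variable (M : Type u) [AddCommGroup M] [Module R M] [Module Aᵐᵒᵖ M] [IsScalarTower R Aᵐᵒᵖ M]

theorem twist_tmul_one (t : M ⊗[R] C) : twist E M (t ⊗ₜ (1 : A)) = t := by
  induction t with
  | zero => simp
  | tmul m c => simp [twist, E.ψ_one]
  | add s t hs ht => simp [add_tmul, hs, ht]

/-- `a ⊗ c ↦ m a ⊗ c`. -/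
def actOn (m : M) : A ⊗[R] C →ₗ[R] M ⊗[R] C :=
  ((rightAct R A M) ∘ₗ TensorProduct.mk R M A m).rTensor C

@[simp] theorem actOn_tmul (m : M) (a : A) (c : C) :
    actOn M m (a ⊗ₜ[R] c) = (op a • m) ⊗ₜ[R] c := by
  simp [actOn]

theorem twist_tmul_tmul (m : M) (c : C) (a : A) :
    twist E M ((m ⊗ₜ c) ⊗ₜ a) = actOn M m (E.ψ (c ⊗ₜ a)) := by
  simp only [twist, LinearMap.comp_apply, LinearEquiv.coe_coe, TensorProduct.assoc_tmul,
    LinearMap.lTensor_tmul]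
  induction E.ψ (c ⊗ₜ a) with
  | zero => simp
  | tmul x y => simp
  | add s t hs ht => simp [tmul_add, hs, ht]

theorem twist_twist (t : M ⊗[R] C) (a b : A) :
    twist E M (twist E M (t ⊗ₜ a) ⊗ₜ b) = twist E M (t ⊗ₜ (a * b)) := by
  induction t with
  | zero => simp
  | add s t hs ht => simp only [add_tmul, map_add, hs, ht]
  | tmul m c =>
    rw [twist_tmul_tmul, twist_tmul_tmul, E.ψ_mul]
    induction E.ψ (c ⊗ₜ a) with
    | zero => simp
    | add s t hs ht => simp only [add_tmul, map_add, hs, ht]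
    | tmul x y =>
      simp only [actOn_tmul, twist_tmul_tmul, TensorProduct.assoc_tmul, LinearMap.lTensor_tmul]
      induction E.ψ (y ⊗ₜ b) with
      | zero => simp
      | add s t hs ht => simp only [tmul_add, map_add, hs, ht]
      | tmul z w => simp [mul_smul]

/-- `M ⊗ C` for a right `A`-module `M`, with the right `A`-action
`(m ⊗ c) a = ∑ m a_ψ ⊗ c^ψ`. -/
def InducedCarrier (_E : EntwiningStructure R A C) (M : Type u) [AddCommGroup M] [Module R M] :
    Type u := M ⊗[R] C

instance : AddCommGroup (InducedCarrier E M) := inferInstanceAs (AddCommGroup (M ⊗[R] C))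

instance : Module R (InducedCarrier E M) := inferInstanceAs (Module R (M ⊗[R] C))

/-- The identity `M ⊗ C → M ⊗ C`, viewed as a map to `InducedCarrier E M`. -/
def toInduced : M ⊗[R] C ≃ₗ[R] InducedCarrier E M := LinearEquiv.refl R (M ⊗[R] C)

instance : Module Aᵐᵒᵖ (InducedCarrier E M) where
  smul a t := twist E M ((show M ⊗[R] C from t) ⊗ₜ a.unop)
  one_smul t := twist_tmul_one E M t
  mul_smul a b t := (twist_twist E M t b.unop a.unop).symm
  smul_zero a := by
    change twist E M ((0 : M ⊗[R] C) ⊗ₜ a.unop) = 0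
    simp
  smul_add a s t := by
    change twist E M (((show M ⊗[R] C from s) + (show M ⊗[R] C from t)) ⊗ₜ a.unop) = _
    rw [add_tmul, map_add]
    rfl
  add_smul a b t := by
    change twist E M ((show M ⊗[R] C from t) ⊗ₜ (a.unop + b.unop)) = _
    rw [tmul_add, map_add]
    rfl
  zero_smul t := by
    change twist E M ((show M ⊗[R] C from t) ⊗ₜ (0 : A)) = 0
    rw [tmul_zero, map_zero]

theorem smul_toInduced (a : A) (t : M ⊗[R] C) :
    op a • toInduced E M t = toInduced E M (twist E M (t ⊗ₜ a)) := rfl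

instance : IsScalarTower R Aᵐᵒᵖ (InducedCarrier E M) where
  smul_assoc r a t := by
    change twist E M ((show M ⊗[R] C from t) ⊗ₜ (r • a.unop)) = _
    rw [tmul_smul, map_smul]
    rfl

/-- `m ⊗ c ↦ ∑ (m ⊗ c₁) ⊗ c₂`. -/
def inducedCoact (R C M : Type u) [CommRing R] [AddCommGroup C] [Module R C] [Coalgebra R C]
    [AddCommGroup M] [Module R M] : M ⊗[R] C →ₗ[R] (M ⊗[R] C) ⊗[R] C :=
  (TensorProduct.assoc R M C C).symm.toLinearMap ∘ₗ CoalgebraStruct.comul.lTensor M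

theorem inducedCoact_tmul (m : M) (c : C) : inducedCoact R C M (m ⊗ₜ c) =
    (TensorProduct.assoc R M C C).symm (m ⊗ₜ CoalgebraStruct.comul c) := by
  simp [inducedCoact]

theorem inducedCoact_coassoc (t : M ⊗[R] C) :
    TensorProduct.assoc R (M ⊗[R] C) C C
      ((inducedCoact R C M).rTensor C (inducedCoact R C M t)) =
    CoalgebraStruct.comul.lTensor (M ⊗[R] C) (inducedCoact R C M t) := by
  induction t with
  | zero => simp
  | add s t hs ht => simp only [map_add, hs, ht]
  | tmul m c =>
    have h1 : ∀ s : C ⊗[R] C, TensorProduct.assoc R (M ⊗[R] C) C C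
        ((inducedCoact R C M).rTensor C ((TensorProduct.assoc R M C C).symm (m ⊗ₜ s))) =
        (TensorProduct.assoc R M C (C ⊗[R] C)).symm (m ⊗ₜ
          TensorProduct.assoc R C C C (CoalgebraStruct.comul.rTensor C s)) := by
      intro s
      induction s with
      | zero => simp
      | add s t hs ht => simp only [tmul_add, map_add, hs, ht]
      | tmul x y =>
        simp only [TensorProduct.assoc_symm_tmul, LinearMap.rTensor_tmul, inducedCoact_tmul]
        induction (CoalgebraStruct.comul x : C ⊗[R] C) with
        | zero => simp
        | add s t hs ht => simp only [tmul_add, add_tmul, map_add, hs, ht]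
        | tmul z w => simp
    have h2 : ∀ s : C ⊗[R] C, CoalgebraStruct.comul.lTensor (M ⊗[R] C)
        ((TensorProduct.assoc R M C C).symm (m ⊗ₜ s)) =
        (TensorProduct.assoc R M C (C ⊗[R] C)).symm (m ⊗ₜ CoalgebraStruct.comul.lTensor C s) := by
      intro s
      induction s with
      | zero => simp
      | add s t hs ht => simp only [tmul_add, map_add, hs, ht]
      | tmul x y => simp
    rw [inducedCoact_tmul, h1, h2, Coalgebra.coassoc_apply]

theorem inducedCoact_counit (t : M ⊗[R] C) :
    TensorProduct.rid R (M ⊗[R] C)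
      (CoalgebraStruct.counit.lTensor (M ⊗[R] C) (inducedCoact R C M t)) = t := by
  induction t with
  | zero => simp
  | add s t hs ht => simp only [map_add, hs, ht]
  | tmul m c =>
    have h : ∀ s : C ⊗[R] C, TensorProduct.rid R (M ⊗[R] C)
        (CoalgebraStruct.counit.lTensor (M ⊗[R] C)
          ((TensorProduct.assoc R M C C).symm (m ⊗ₜ s))) =
        m ⊗ₜ TensorProduct.rid R C (CoalgebraStruct.counit.lTensor C s) := by
      intro s
      induction s with
      | zero => simp
      | add s t hs ht => simp only [tmul_add, map_add, hs, ht]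
      | tmul x y => simp
    rw [inducedCoact_tmul, h, Coalgebra.lTensor_counit_comul]
    simp

theorem inducedCoact_twist (t : M ⊗[R] C) (a : A) :
    (toInduced E M).toLinearMap.rTensor C (inducedCoact R C M (twist E M (t ⊗ₜ a))) =
      twist E (InducedCarrier E M)
        ((toInduced E M).toLinearMap.rTensor C (inducedCoact R C M t) ⊗ₜ a) := by
  induction t with
  | zero => simp
  | add s t hs ht => simp only [add_tmul, map_add, hs, ht]
  | tmul m c =>
    have h1 : ∀ s : A ⊗[R] C, inducedCoact R C M (actOn M m s) =
        (actOn M m).rTensor C ((TensorProduct.assoc R A C C).symm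
          (CoalgebraStruct.comul.lTensor A s)) := by
      intro s
      induction s with
      | zero => simp
      | add s t hs ht => simp only [map_add, hs, ht]
      | tmul x y =>
        simp only [actOn_tmul, inducedCoact_tmul, LinearMap.lTensor_tmul]
        induction (CoalgebraStruct.comul y : C ⊗[R] C) with
        | zero => simp
        | add s t hs ht => simp only [tmul_add, map_add, hs, ht]
        | tmul z w => simp
    have h2 : ∀ s : C ⊗[R] C, (toInduced E M).toLinearMap.rTensor C
        ((actOn M m).rTensor C (E.ψ.rTensor C
          ((TensorProduct.assoc R C A C).symm (E.ψ.lTensor C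
            (TensorProduct.assoc R C C A (s ⊗ₜ a)))))) =
        twist E (InducedCarrier E M) ((toInduced E M).toLinearMap.rTensor C
          ((TensorProduct.assoc R M C C).symm (m ⊗ₜ s)) ⊗ₜ[R] a) := by
      intro s
      induction s with
      | zero => simp
      | add s t hs ht => simp only [add_tmul, tmul_add, map_add, hs, ht]
      | tmul x y =>
        simp only [TensorProduct.assoc_tmul, TensorProduct.assoc_symm_tmul,
          LinearMap.lTensor_tmul, LinearMap.rTensor_tmul, twist_tmul_tmul]
        induction E.ψ (y ⊗ₜ a) with
        | zero => simp
        | add s t hs ht => simp only [tmul_add, map_add, hs, ht]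
        | tmul z w => simp [smul_toInduced, twist_tmul_tmul]
    rw [twist_tmul_tmul, h1, E.ψ_comul, LinearEquiv.symm_apply_apply, h2, inducedCoact_tmul]

/-- The entwined module `M ⊗ C` with `(m ⊗ c) a = ∑ m a_ψ ⊗ c^ψ` and coaction
`m ⊗ c ↦ ∑ (m ⊗ c₁) ⊗ c₂`. -/
def inducedModule : EntwinedModule E where
  carrier := InducedCarrier E M
  coact := (toInduced E M).toLinearMap.rTensor C ∘ₗ inducedCoact R C M ∘ₗ
    (toInduced E M).symm.toLinearMap
  coact_coassoc := by
    intro m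
    obtain ⟨t, rfl⟩ := (toInduced E M).surjective m
    have h1 : ∀ (s : (M ⊗[R] C) ⊗[R] C) (d : C), TensorProduct.assoc R (InducedCarrier E M) C C
        ((toInduced E M).toLinearMap.rTensor C s ⊗ₜ d) =
        (toInduced E M).toLinearMap.rTensor (C ⊗[R] C)
          (TensorProduct.assoc R (M ⊗[R] C) C C (s ⊗ₜ d)) := by
      intro s d
      induction s with
      | zero => simp
      | add s t hs ht => simp only [add_tmul, map_add, hs, ht]
      | tmul x y => simp
    have h2 : ∀ s : (M ⊗[R] C) ⊗[R] C, TensorProduct.assoc R (InducedCarrier E M) C C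
        (((toInduced E M).toLinearMap.rTensor C ∘ₗ inducedCoact R C M ∘ₗ
          (toInduced E M).symm.toLinearMap).rTensor C ((toInduced E M).toLinearMap.rTensor C s)) =
        (toInduced E M).toLinearMap.rTensor (C ⊗[R] C)
          (TensorProduct.assoc R (M ⊗[R] C) C C ((inducedCoact R C M).rTensor C s)) := by
      intro s
      induction s with
      | zero => simp
      | add s t hs ht => simp only [map_add, hs, ht]
      | tmul x y => simp [h1]
    have h3 : ∀ s : (M ⊗[R] C) ⊗[R] C, CoalgebraStruct.comul.lTensor (InducedCarrier E M)
        ((toInduced E M).toLinearMap.rTensor C s) =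
        (toInduced E M).toLinearMap.rTensor (C ⊗[R] C)
          (CoalgebraStruct.comul.lTensor (M ⊗[R] C) s) := by
      intro s
      induction s with
      | zero => simp
      | add s t hs ht => simp only [map_add, hs, ht]
      | tmul x y => simp
    have h4 : ((toInduced E M).toLinearMap.rTensor C ∘ₗ inducedCoact R C M ∘ₗ
        (toInduced E M).symm.toLinearMap) (toInduced E M t) =
        (toInduced E M).toLinearMap.rTensor C (inducedCoact R C M t) := rfl
    rw [h4, h2, h3, inducedCoact_coassoc]
  coact_counit := by
    intro m
    obtain ⟨t, rfl⟩ := (toInduced E M).surjective m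
    have h3 : ∀ s : (M ⊗[R] C) ⊗[R] C, TensorProduct.rid R (InducedCarrier E M)
        (CoalgebraStruct.counit.lTensor (InducedCarrier E M)
          ((toInduced E M).toLinearMap.rTensor C s)) =
        toInduced E M (TensorProduct.rid R (M ⊗[R] C)
          (CoalgebraStruct.counit.lTensor (M ⊗[R] C) s)) := by
      intro s
      induction s with
      | zero => simp
      | add s t hs ht => simp only [map_add, hs, ht]
      | tmul x y => simp
    simp only [LinearMap.comp_apply, LinearEquiv.coe_coe, LinearEquiv.symm_apply_apply]
    rw [h3, inducedCoact_counit]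
  coact_smul := by
    intro m a
    obtain ⟨t, rfl⟩ := (toInduced E M).surjective m
    have := inducedCoact_twist E M t a
    simpa [smul_toInduced] using this

theorem inducedModule_coact (t : M ⊗[R] C) : (inducedModule E M).coact (toInduced E M t) =
    (toInduced E M).toLinearMap.rTensor C (inducedCoact R C M t) := rfl

end Induced

/-! ### The ring `#_ψ^op(C, A)` -/

/-- `#_ψ^op(C, A)`: the `R`-module `Hom_R(C, A)` with the multiplication
`(f g)(c) = ∑ f(c₂)_ψ g(c₁^ψ)` and unit `η ∘ ε`. -/
def SmashOp (_E : EntwiningStructure R A C) : Type u := C →ₗ[R] A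

namespace SmashOp

instance : AddCommGroup (SmashOp E) := inferInstanceAs (AddCommGroup (C →ₗ[R] A))

instance : Module R (SmashOp E) := inferInstanceAs (Module R (C →ₗ[R] A))

variable {E}

/-- An element of `#_ψ^op(C, A)` as a linear map `C → A`. -/
def toLin (f : SmashOp E) : C →ₗ[R] A := f

variable (E)

/-- A linear map `C → A` as an element of `#_ψ^op(C, A)`. -/
def ofLin (f : C →ₗ[R] A) : SmashOp E := f

@[simp] theorem toLin_ofLin (f : C →ₗ[R] A) : (ofLin E f).toLin = f := rfl

instance : Mul (SmashOp E) where
  mul f g := (LinearMap.mul' R A ∘ₗ g.toLin.lTensor A ∘ₗ E.ψ ∘ₗ f.toLin.lTensor C ∘ₗ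
    CoalgebraStruct.comul : C →ₗ[R] A)

instance : One (SmashOp E) where
  one := (Algebra.linearMap R A ∘ₗ CoalgebraStruct.counit : C →ₗ[R] A)

variable {E}

theorem mul_apply (f g : SmashOp E) (c : C) : (f * g).toLin c =
    LinearMap.mul' R A (g.toLin.lTensor A (E.ψ (f.toLin.lTensor C (CoalgebraStruct.comul c)))) :=
  rfl

theorem one_toLin :
    (1 : SmashOp E).toLin = Algebra.linearMap R A ∘ₗ CoalgebraStruct.counit := rfl

theorem actBy_one (M : EntwinedModule E) (m : M) : M.actBy (1 : SmashOp E).toLin m = m := by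
  refine Eq.trans ?_ (M.coact_counit m)
  simp only [EntwinedModule.actBy, one_toLin, LinearMap.comp_apply]
  induction M.coact m with
  | zero => simp
  | add s t hs ht => simp only [map_add, hs, ht]
  | tmul x y =>
    simp [Algebra.algebraMap_eq_smul_one]

theorem actBy_mul (M : EntwinedModule E) (f g : SmashOp E) (m : M) :
    M.actBy (f * g).toLin m = M.actBy g.toLin (M.actBy f.toLin m) := by
  let Φ : M ⊗[R] (C ⊗[R] C) →ₗ[R] M := rightAct R A M ∘ₗ
    (LinearMap.mul' R A ∘ₗ g.toLin.lTensor A ∘ₗ E.ψ ∘ₗ f.toLin.lTensor C).lTensor M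
  have h1 : ∀ s : M ⊗[R] C, rightAct R A M ((f * g).toLin.lTensor M s) =
      Φ (CoalgebraStruct.comul.lTensor M s) := by
    intro s
    induction s with
    | zero => simp
    | add s t hs ht => simp only [map_add, hs, ht]
    | tmul x y => simp [Φ, mul_apply]
  have h3 : ∀ (s : M ⊗[R] C) (d : C), Φ (TensorProduct.assoc R M C C (s ⊗ₜ d)) =
      rightAct R A M (g.toLin.lTensor M (twist E M (s ⊗ₜ f.toLin d))) := by
    intro s d
    induction s with
    | zero => simp
    | add s t hs ht => simp only [add_tmul, map_add, hs, ht]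
    | tmul x y =>
      simp only [TensorProduct.assoc_tmul, twist_tmul_tmul, Φ, LinearMap.comp_apply,
        LinearMap.lTensor_tmul]
      induction E.ψ (y ⊗ₜ f.toLin d) with
      | zero => simp
      | add s t hs ht => simp only [tmul_add, map_add, hs, ht]
      | tmul z w => simp [mul_smul]
  have h2 : ∀ s : M ⊗[R] C, Φ (TensorProduct.assoc R M C C (M.coact.rTensor C s)) =
      M.actBy g.toLin (rightAct R A M (f.toLin.lTensor M s)) := by
    intro s
    induction s with
    | zero => simp
    | add s t hs ht => simp only [map_add, hs, ht]
    | tmul x y =>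
      simp only [LinearMap.rTensor_tmul, LinearMap.lTensor_tmul, h3, rightAct_tmul]
      simp [EntwinedModule.actBy, M.coact_smul]
  simp only [EntwinedModule.actBy, LinearMap.comp_apply] at h2 ⊢
  rw [h1, ← M.coact_coassoc, h2]

theorem actBy_induced (f : C →ₗ[R] A) (c : C) :
    (inducedModule E A).actBy f (toInduced E A (1 ⊗ₜ c)) =
      toInduced E A (E.ψ (f.lTensor C (CoalgebraStruct.comul c))) := by
  have h0 : ∀ s : C ⊗[R] C, rightAct R A (InducedCarrier E A)
      (f.lTensor (InducedCarrier E A) ((toInduced E A).toLinearMap.rTensor C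
        ((TensorProduct.assoc R A C C).symm (1 ⊗ₜ s)))) =
      toInduced E A (E.ψ (f.lTensor C s)) := by
    intro s
    induction s with
    | zero => simp
    | add s t hs ht => simp only [tmul_add, map_add, hs, ht]
    | tmul x y =>
      simp only [TensorProduct.assoc_symm_tmul, LinearMap.rTensor_tmul, LinearMap.lTensor_tmul,
        LinearEquiv.coe_coe, rightAct_tmul, smul_toInduced, twist_tmul_tmul]
      congr 1
      induction E.ψ (x ⊗ₜ f y) with
      | zero => simp
      | add s t hs ht => simp only [map_add, hs, ht]
      | tmul z w => simp
  refine Eq.trans ?_ (h0 _)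
  rw [← inducedCoact_tmul, ← inducedModule_coact]
  rfl

theorem ext_actBy {f g : SmashOp E}
    (h : ∀ t, (inducedModule E A).actBy f.toLin t = (inducedModule E A).actBy g.toLin t) :
    f = g := by
  have key : ∀ (f : SmashOp E) (c : C), f.toLin c = TensorProduct.rid R A
      (CoalgebraStruct.counit.lTensor A (E.ψ (f.toLin.lTensor C (CoalgebraStruct.comul c)))) := by
    intro f c
    have h2 : ∀ s : C ⊗[R] C, TensorProduct.rid R A (CoalgebraStruct.counit.lTensor A
        (E.ψ (f.toLin.lTensor C s))) =
        f.toLin (TensorProduct.lid R C (CoalgebraStruct.counit.rTensor C s)) := by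
      intro s
      induction s with
      | zero => simp
      | add s t hs ht => simp only [map_add, hs, ht]
      | tmul x y => simp [E.ψ_counit]
    rw [h2, Coalgebra.rTensor_counit_comul]
    simp
  refine LinearMap.ext fun c => ?_
  refine (key f c).trans (Eq.trans ?_ (key g c).symm)
  have := h (toInduced E A (1 ⊗ₜ c))
  rw [actBy_induced, actBy_induced] at this
  rw [(toInduced E A).injective this]

theorem toLin_add (f g : SmashOp E) : (f + g).toLin = f.toLin + g.toLin := rfl

theorem toLin_smul (r : R) (f : SmashOp E) : (r • f).toLin = r • f.toLin := rfl

theorem toLin_zero : (0 : SmashOp E).toLin = 0 := rfl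

theorem toLin_ext {f g : SmashOp E} (h : ∀ c, f.toLin c = g.toLin c) : f = g := LinearMap.ext h

variable (E)

instance : Ring (SmashOp E) :=
  { (inferInstance : AddCommGroup (SmashOp E)), (inferInstance : Mul (SmashOp E)),
    (inferInstance : One (SmashOp E)) with
    left_distrib := fun f g h => toLin_ext fun c => by
      simp [toLin_add, mul_apply, LinearMap.lTensor_add]
    right_distrib := fun f g h => toLin_ext fun c => by
      simp [toLin_add, mul_apply, LinearMap.lTensor_add]
    zero_mul := fun f => toLin_ext fun c => by simp [toLin_zero, mul_apply]
    mul_zero := fun f => toLin_ext fun c => by simp [toLin_zero, mul_apply]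
    mul_assoc := fun f g h => ext_actBy fun t => by simp only [actBy_mul]
    one_mul := fun f => ext_actBy fun t => by rw [actBy_mul, actBy_one]
    mul_one := fun f => ext_actBy fun t => by rw [actBy_mul, actBy_one] }

instance : Algebra R (SmashOp E) :=
  Algebra.ofModule
    (fun r f g => toLin_ext fun c => by simp [toLin_smul, mul_apply, LinearMap.lTensor_smul])
    (fun r f g => toLin_ext fun c => by simp [toLin_smul, mul_apply, LinearMap.lTensor_smul])

/-- The ring homomorphism `A → #_ψ^op(C, A)`, `a ↦ ε(-) a`, that makes `#_ψ^op(C, A)` an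
`A`-ring. -/
def ofAlg : A →+* SmashOp E where
  toFun a := ofLin E ((CoalgebraStruct.counit : C →ₗ[R] R).smulRight a)
  map_one' := toLin_ext fun c => by
    simp [one_toLin, Algebra.algebraMap_eq_smul_one]
  map_zero' := toLin_ext fun c => by simp [toLin_zero]
  map_add' a b := toLin_ext fun c => by simp [toLin_add]
  map_mul' a b := toLin_ext fun c => by
    have h1 : ∀ s : C ⊗[R] C,
        ((CoalgebraStruct.counit : C →ₗ[R] R).smulRight a).lTensor C s =
          TensorProduct.rid R C (CoalgebraStruct.counit.lTensor C s) ⊗ₜ a := by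
      intro s
      induction s with
      | zero => simp
      | add s t hs ht => simp only [add_tmul, map_add, hs, ht]
      | tmul x y => simp [smul_tmul]
    have h2 : ∀ t : A ⊗[R] C, LinearMap.mul' R A
        (((CoalgebraStruct.counit : C →ₗ[R] R).smulRight b).lTensor A t) =
          TensorProduct.rid R A (CoalgebraStruct.counit.lTensor A t) * b := by
      intro t
      induction t with
      | zero => simp
      | add s t hs ht => simp only [add_mul, map_add, hs, ht]
      | tmul x y => simp
    rw [mul_apply, toLin_ofLin, toLin_ofLin, toLin_ofLin, h1, Coalgebra.lTensor_counit_comul, h2,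
      TensorProduct.rid_tmul, one_smul, E.ψ_counit]
    simp

end SmashOp

/-- Every entwined module is a right `#_ψ^op(C, A)`-module through `m f = ∑ m₀ f(m₁)`. -/
instance smashModule (M : EntwinedModule E) : Module (SmashOp E)ᵐᵒᵖ M where
  smul f m := M.actBy f.unop.toLin m
  one_smul m := SmashOp.actBy_one M m
  mul_smul f g m := SmashOp.actBy_mul M g.unop f.unop m
  smul_zero f := map_zero _
  smul_add f m n := map_add _ m n
  add_smul f g m := by
    change M.actBy (f.unop.toLin + g.unop.toLin) m = M.actBy f.unop.toLin m + M.actBy g.unop.toLin m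
    simp [EntwinedModule.actBy, LinearMap.lTensor_add]
  zero_smul m := by
    change M.actBy 0 m = 0
    simp [EntwinedModule.actBy]

/-- The functor `M_A^C(ψ) → M_{#_ψ^op(C, A)}`, the identity on underlying sets, with
`m f = ∑ m₀ f(m₁)`. -/
def toSmashModules : EntwinedModule E ⥤ ModuleCat.{u} (SmashOp E)ᵐᵒᵖ where
  obj M := ModuleCat.of (SmashOp E)ᵐᵒᵖ M
  map {M N} h := ModuleCat.ofHom
    { toFun := h.toLinearMap
      map_add' := map_add _
      map_smul' := fun f m => by
        have h1 : ∀ s : M ⊗[R] C, h.toLinearMap (rightAct R A M (f.unop.toLin.lTensor M s)) =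
            rightAct R A N (f.unop.toLin.lTensor N (h.toLinearMap.rTensor C s)) := by
          intro s
          induction s with
          | zero => simp
          | add s t hs ht => simp only [map_add, hs, ht]
          | tmul x y => simp [h.map_smul]
        change h.toLinearMap (rightAct R A M (f.unop.toLin.lTensor M (M.coact m))) =
          rightAct R A N (f.unop.toLin.lTensor N (N.coact (h.toLinearMap m)))
        rw [h1, h.map_coact] }

/-! ### The `α`-condition and `#`-rational modules -/

/-- `α_M^ψ : M ⊗ C → Hom_R(#_ψ^op(C, A), M)`, `m ⊗ c ↦ [f ↦ m f(c)]`. -/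
def alphaMap (M : Type u) [AddCommGroup M] [Module R M] [Module Aᵐᵒᵖ M]
    [IsScalarTower R Aᵐᵒᵖ M] : M ⊗[R] C →ₗ[R] SmashOp E →ₗ[R] M :=
  LinearMap.mk₂ R (fun t f => rightAct R A M (f.toLin.lTensor M t))
    (fun s t f => by simp) (fun r t f => by simp)
    (fun t f g => by simp [SmashOp.toLin_add, LinearMap.lTensor_add])
    (fun r t f => by simp [SmashOp.toLin_smul, LinearMap.lTensor_smul])

@[simp] theorem alphaMap_tmul (M : Type u) [AddCommGroup M] [Module R M] [Module Aᵐᵒᵖ M]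
    [IsScalarTower R Aᵐᵒᵖ M] (m : M) (c : C) (f : SmashOp E) :
    alphaMap E M (m ⊗ₜ c) f = op (f.toLin c) • m := by
  simp [alphaMap]

/-- `(A, C, ψ)` satisfies the `α`-condition: `α_M^ψ` is injective for every right
`A`-module `M`. -/
def EntwiningStructure.AlphaCondition : Prop :=
  ∀ (M : Type u) [AddCommGroup M] [Module R M] [Module Aᵐᵒᵖ M] [IsScalarTower R Aᵐᵒᵖ M],
    Function.Injective (alphaMap E M)

section Rational

variable (M : Type u) [AddCommGroup M] [Module (SmashOp E)ᵐᵒᵖ M]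

/-- The `R`-module underlying a right `#_ψ^op(C, A)`-module. -/
abbrev restrictBase : Module R M := Module.compHom M (algebraMap R (SmashOp E)ᵐᵒᵖ)

/-- The right `A`-module underlying a right `#_ψ^op(C, A)`-module, along `A → #_ψ^op(C, A)`. -/
abbrev restrictAlg : Module Aᵐᵒᵖ M := Module.compHom M (SmashOp.ofAlg E).op

theorem restrict_isScalarTower :
    letI := restrictBase E M
    letI := restrictAlg E M
    IsScalarTower R Aᵐᵒᵖ M := by
  let _ := restrictBase E M
  let _ := restrictAlg E M
  refine ⟨fun r a m => ?_⟩
  change op (SmashOp.ofAlg E (r • a.unop)) • m =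
    algebraMap R (SmashOp E)ᵐᵒᵖ r • op (SmashOp.ofAlg E a.unop) • m
  have : SmashOp.ofAlg E (r • a.unop) = r • SmashOp.ofAlg E a.unop :=
    SmashOp.toLin_ext fun c => by
      change (CoalgebraStruct.counit c : R) • r • a.unop = r • (CoalgebraStruct.counit c : R) • a.unop
      rw [smul_comm]
  rw [this, MulOpposite.op_smul, algebra_compatible_smul (SmashOp E)ᵐᵒᵖ, smul_eq_mul, mul_smul]

/-- `Rat^C(M) = ρ_M⁻¹(M ⊗ C)`: the elements `m` for which `f ↦ m f` is in the image of
`α_M^ψ`. -/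
def ratPart : Set M :=
  letI := restrictBase E M
  letI := restrictAlg E M
  haveI := restrict_isScalarTower E M
  {m | ∃ t : M ⊗[R] C, ∀ f : SmashOp E, alphaMap E M t f = op f • m}

end Rational

/-- `#`-rational right `#_ψ^op(C, A)`-modules. -/
def IsRational : ObjectProperty (ModuleCat.{u} (SmashOp E)ᵐᵒᵖ) :=
  fun M => ratPart E M = Set.univ

end Entwining

/-! ### Subgenerated modules and isomorphisms of categories -/

section Categories

open CategoryTheory

/-- `G` is `K`-generated: a quotient of a direct sum of copies of `K`. -/
def IsGeneratedBy {S : Type u} [Ring S] (K G : ModuleCat.{u} S) : Prop :=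
  ∃ (ι : Type u) (p : (ι →₀ K) →ₗ[S] G), Function.Surjective p

/-- The objects of `σ[K]`: modules isomorphic to a submodule of a `K`-generated module. -/
def IsSubgeneratedBy {S : Type u} [Ring S] (K : ModuleCat.{u} S) :
    ObjectProperty (ModuleCat.{u} S) :=
  fun N => ∃ G : ModuleCat.{u} S, IsGeneratedBy K G ∧ ∃ i : N →ₗ[S] G, Function.Injective i

/-- A functor is an isomorphism of categories if it has a strict two-sided inverse. -/
def IsIsoOfCategories {𝒞 𝒟 : Type*} [Category 𝒞] [Category 𝒟] (F : 𝒞 ⥤ 𝒟) : Prop :=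
  ∃ G : 𝒟 ⥤ 𝒞, F ⋙ G = 𝟭 𝒞 ∧ G ⋙ F = 𝟭 𝒟

end Categories

/-! ### The dual entwining map -/

section Dual

variable {R A C : Type u} [CommRing R] [IsNoetherianRing R] [Ring A] [Algebra R A]
  [IsAlphaAlgebra R A] [AddCommGroup C] [Module R C] [Coalgebra R C]

/-- The underlying type of a subalgebra `A'` of the convolution algebra `C^*`. -/
def DualAlg (A' : Subalgebra R (WithConv (C →ₗ[R] R))) : Type u := A'

instance (A' : Subalgebra R (WithConv (C →ₗ[R] R))) : Ring (DualAlg A') :=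
  inferInstanceAs (Ring A')

instance (A' : Subalgebra R (WithConv (C →ₗ[R] R))) : Algebra R (DualAlg A') :=
  inferInstanceAs (Algebra R A')

/-- The inclusion `A' → C^*`. -/
def dualAlgIncl (A' : Subalgebra R (WithConv (C →ₗ[R] R))) : DualAlg A' →ₗ[R] Module.Dual R C where
  toFun g := g.1.ofConv
  map_add' _ _ := rfl
  map_smul' _ _ := rfl

theorem dualAlgIncl_injective (A' : Subalgebra R (WithConv (C →ₗ[R] R))) :
    Function.Injective (dualAlgIncl A') :=
  fun _ _ h => Subtype.ext (WithConv.ofConv_injective h)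

/-- The inclusion `C' → A^*` of a subcoalgebra of `A°`. -/
def dualCoalgIncl (C' : Subcoalgebra R (FiniteDual R A)) : C' →ₗ[R] Module.Dual R A :=
  FiniteDual.incl R A ∘ₗ C'.incl

theorem dualCoalgIncl_isPureMap (C' : Subcoalgebra R (FiniteDual R A)) :
    IsPureMap (LinearMap.ltoFun R A R R ∘ₗ dualCoalgIncl C') := by
  intro N _ _
  have h : LinearMap.ltoFun R A R R ∘ₗ dualCoalgIncl C' =
      (LinearMap.ltoFun R A R R ∘ₗ FiniteDual.incl R A) ∘ₗ C'.incl := rfl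
  rw [h, LinearMap.rTensor_comp, LinearMap.coe_comp]
  exact (finiteDual_isPureMap R A N).comp (C'.rTensor_incl_injective N)

/-- `C' ⊗ A' → (A ⊗ C)^*`, `f ⊗ g ↦ [a ⊗ c ↦ f(a) g(c)]`. -/
def pairCA (A' : Subalgebra R (WithConv (C →ₗ[R] R))) (C' : Subcoalgebra R (FiniteDual R A)) :
    C' ⊗[R] DualAlg A' →ₗ[R] Module.Dual R (A ⊗[R] C) :=
  pairTensor (dualCoalgIncl C') (dualAlgIncl A')

/-- `A' ⊗ C' → (C ⊗ A)^*`, `g ⊗ f ↦ [c ⊗ a ↦ g(c) f(a)]`. -/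
def pairAC (A' : Subalgebra R (WithConv (C →ₗ[R] R))) (C' : Subcoalgebra R (FiniteDual R A)) :
    DualAlg A' ⊗[R] C' →ₗ[R] Module.Dual R (C ⊗[R] A) :=
  pairTensor (dualAlgIncl A') (dualCoalgIncl C')

theorem pairAC_injective (A' : Subalgebra R (WithConv (C →ₗ[R] R)))
    (C' : Subcoalgebra R (FiniteDual R A)) : Function.Injective (pairAC A' C') :=
  pairTensor_injective _ _ (dualAlgIncl_injective A') (dualCoalgIncl_isPureMap C')

variable (E : EntwiningStructure R A C) (A' : Subalgebra R (WithConv (C →ₗ[R] R)))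
  (C' : Subcoalgebra R (FiniteDual R A))

/-- `ψ^*(C' ⊗ A') ⊆ A' ⊗ C'` inside `(C ⊗ A)^*`. -/
def DualStable : Prop :=
  (LinearMap.range (pairCA A' C')).map E.ψ.dualMap ≤ LinearMap.range (pairAC A' C')

/-- The map `φ : C' ⊗ A' → A' ⊗ C'` induced by `ψ^*`: the unique linear map with
`φ(f ⊗ g)(c ⊗ a) = ∑ f(a_ψ) g(c^ψ)`. -/
def dualEntwiningMap (h : DualStable E A' C') : C' ⊗[R] DualAlg A' →ₗ[R] DualAlg A' ⊗[R] C' :=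
  factorThrough (pairAC A' C') (pairAC_injective A' C') (E.ψ.dualMap ∘ₗ pairCA A' C')
    (fun x => h ⟨_, ⟨x, rfl⟩, rfl⟩)

theorem pairAC_dualEntwiningMap (h : DualStable E A' C') (t : C' ⊗[R] DualAlg A') :
    pairAC A' C' (dualEntwiningMap E A' C' h t) = pairCA A' C' t ∘ₗ E.ψ :=
  factorThrough_spec _ (pairAC_injective A' C') _ _ t

end Dual

end

end DualEntwining

open DualEntwining CategoryTheory TensorProduct

/-!
The map `φ` is the adjoint of `ψ` for the pairings of `C' ⊗ A'` with `A ⊗ C` and of `A' ⊗ C'` with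
`C ⊗ A`, so each entwining axiom of `φ` is the transpose of one for `ψ`: multiplicativity of `φ`
comes from the compatibility of `ψ` with `Δ_C`, and conversely. The iterated pairings are injective
because `C' ⊆ R^A` is pure. Purity also gives the `α`-condition: an element of `M ⊗ C'` is
already detected by the functionals on `C'` given by evaluation at elements of `A`.

Under the `α`-condition the orbit maps `f ↦ m f` of a rational module determine a map
`ρ : M → M ⊗ C`, and the axioms of a coaction can be tested after applying `α`, where they become
the module axioms. Coassociativity is tested on `M ⊗ C`, where `α_M^ψ(t)(f g) = α_M^ψ(t f)(g)`.

Rational modules are closed under submodules: if `i m` is rational in `N`, with orbit map `α(t)`,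
the image of `t` in `(N / M) ⊗ C` is killed by `α`, hence is zero, so `t` comes from `M ⊗ C`. Since
they are also closed under sums and images, `σ[A ⊗ C]` consists of rational modules. Conversely, the
coaction embeds an entwined module `M` into `M ⊗ C`, which is generated by `A ⊗ C` through the maps
`a ⊗ c ↦ m a ⊗ c`. When `C` has a dual basis `(e_i, g_i)`, every `m` is rational, with
`ρ(m) = ∑ m g_i ⊗ e_i`.
-/

namespace DualEntwining

noncomputable section

open MulOpposite

theorem isIsoOfCategories_of_isIso {𝒞 𝒟 : Type*} [Category 𝒞] [Category 𝒟] (F : 𝒞 ⥤ 𝒟)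
    [F.IsIso] : IsIsoOfCategories F :=
  ⟨F.strictInv, F.asIsomorphism.unit_eq.symm, F.asIsomorphism.counit_eq⟩

section PairTensor

variable {R X X' Y Y' Z V V' W W' U : Type u} [CommRing R]
  [AddCommGroup X] [Module R X] [AddCommGroup X'] [Module R X']
  [AddCommGroup Y] [Module R Y] [AddCommGroup Y'] [Module R Y'] [AddCommGroup Z] [Module R Z]
  [AddCommGroup V] [Module R V] [AddCommGroup V'] [Module R V']
  [AddCommGroup W] [Module R W] [AddCommGroup W'] [Module R W'] [AddCommGroup U] [Module R U]

theorem pairTensor_flip (i : X →ₗ[R] Module.Dual R V) (j : Y →ₗ[R] Module.Dual R W)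
    (t : X ⊗[R] Y) (w : V ⊗[R] W) :
    pairTensor i.flip j.flip w t = pairTensor i j t w := by
  suffices h : (pairTensor i.flip j.flip).flip = pairTensor i j from LinearMap.congr_fun₂ h t w
  ext
  simp

theorem pairTensor_assoc (i : X →ₗ[R] Module.Dual R V) (j : Y →ₗ[R] Module.Dual R W)
    (k : Z →ₗ[R] Module.Dual R U) (t : (X ⊗[R] Y) ⊗[R] Z) (w : (V ⊗[R] W) ⊗[R] U) :
    pairTensor i (pairTensor j k) (TensorProduct.assoc R X Y Z t) (TensorProduct.assoc R V W U w) =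
      pairTensor (pairTensor i j) k t w := by
  suffices h : (TensorProduct.assoc R V W U).toLinearMap.dualMap ∘ₗ
      pairTensor i (pairTensor j k) ∘ₗ (TensorProduct.assoc R X Y Z).toLinearMap =
      pairTensor (pairTensor i j) k from LinearMap.congr_fun₂ h t w
  ext
  simp [mul_assoc]

theorem pairTensor_rTensor {i : X →ₗ[R] Module.Dual R V} {i' : X' →ₗ[R] Module.Dual R V'}
    {φ : X' →ₗ[R] X} {ψ : V →ₗ[R] V'} (h : ∀ x v, i (φ x) v = i' x (ψ v))
    (j : Y →ₗ[R] Module.Dual R W) (t : X' ⊗[R] Y) (w : V ⊗[R] W) :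
    pairTensor i j (φ.rTensor Y t) w = pairTensor i' j t (ψ.rTensor W w) := by
  suffices h : pairTensor i j ∘ₗ φ.rTensor Y = (ψ.rTensor W).dualMap ∘ₗ pairTensor i' j from
    LinearMap.congr_fun₂ h t w
  ext
  simp [h]

theorem pairTensor_lTensor (i : X →ₗ[R] Module.Dual R V) {j : Y →ₗ[R] Module.Dual R W}
    {j' : Y' →ₗ[R] Module.Dual R W'} {φ : Y' →ₗ[R] Y} {ψ : W →ₗ[R] W'}
    (h : ∀ y w, j (φ y) w = j' y (ψ w)) (t : X ⊗[R] Y') (w : V ⊗[R] W) :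
    pairTensor i j (φ.lTensor X t) w = pairTensor i j' t (ψ.lTensor V w) := by
  suffices h : pairTensor i j ∘ₗ φ.lTensor X = (ψ.lTensor V).dualMap ∘ₗ pairTensor i j' from
    LinearMap.congr_fun₂ h t w
  ext
  simp [h]

theorem pairTensor_tmul_left (i : X →ₗ[R] Module.Dual R V) (j : Y →ₗ[R] Module.Dual R W)
    (x : X) (y : Y) (t : V ⊗[R] W) :
    pairTensor i j (x ⊗ₜ y) t = i x (evalRight V (j y) t) := by
  induction t with
  | zero => simp
  | tmul v w => simp [mul_comm]
  | add s t hs ht => simp only [map_add, hs, ht]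

end PairTensor

section DualPairing

variable {R B D : Type u} [CommRing R] [Ring B] [Algebra R B] [AddCommGroup D] [Module R D]
  [Coalgebra R D]

/-- A bilinear pairing of an algebra `B` with a coalgebra `D` that exhibits `B → D^*` as a morphism
of algebras into the convolution algebra. A pairing of `D` with `B` is meant to be flipped first. -/
structure IsDualPairing (β : B →ₗ[R] Module.Dual R D) : Prop where
  one_apply : ∀ d, β 1 d = CoalgebraStruct.counit d
  mul_apply : ∀ b b' d, β (b * b') d = pairTensor β β (b ⊗ₜ b') (CoalgebraStruct.comul d)

theorem IsDualPairing.mul'_apply {β : B →ₗ[R] Module.Dual R D} (hβ : IsDualPairing β)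
    (t : B ⊗[R] B) (d : D) :
    β (LinearMap.mul' R B t) d = pairTensor β β t (CoalgebraStruct.comul d) := by
  induction t with
  | zero => simp
  | tmul b b' => exact hβ.mul_apply b b' d
  | add s t hs ht => simp only [map_add, LinearMap.add_apply, hs, ht]

end DualPairing

namespace EntwiningStructure

variable {R A B C D : Type u} [CommRing R] [Ring A] [Algebra R A] [Ring B] [Algebra R B]
  [AddCommGroup C] [Module R C] [Coalgebra R C] [AddCommGroup D] [Module R D]
  (E : EntwiningStructure R A C) {i : B →ₗ[R] Module.Dual R C} {j : D →ₗ[R] Module.Dual R A}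
  {φ : D ⊗[R] B →ₗ[R] B ⊗[R] D}

theorem adjoint_one (hi : IsDualPairing i) (hij : Function.Injective (pairTensor i j))
    (hφ : ∀ t w, pairTensor i j (φ t) w = pairTensor j i t (E.ψ w)) (f : D) :
    φ (f ⊗ₜ 1) = 1 ⊗ₜ f := by
  refine hij (TensorProduct.ext' fun c a => ?_)
  have hi_one : i 1 = CoalgebraStruct.counit := LinearMap.ext hi.one_apply
  have hψ : evalRight A CoalgebraStruct.counit (E.ψ (c ⊗ₜ a)) =
      (CoalgebraStruct.counit c : R) • a := E.ψ_counit c a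
  rw [hφ, pairTensor_tmul_left, hi_one, hψ, pairTensor_tmul, hi_one, map_smul, smul_eq_mul]

theorem adjoint_mul (hi : IsDualPairing i) (hij : Function.Injective (pairTensor i j))
    (hφ : ∀ t w, pairTensor i j (φ t) w = pairTensor j i t (E.ψ w)) (f : D) (g g' : B) :
    φ (f ⊗ₜ (g * g')) = (LinearMap.mul' R B).rTensor D ((TensorProduct.assoc R B B D).symm
      (φ.lTensor B (TensorProduct.assoc R B D B (φ (f ⊗ₜ g) ⊗ₜ g')))) := by
  refine hij (TensorProduct.ext' fun c a => ?_)
  calc pairTensor i j (φ (f ⊗ₜ (g * g'))) (c ⊗ₜ a)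
    _ = pairTensor j i ((LinearMap.mul' R B).lTensor D
          (TensorProduct.assoc R D B B ((f ⊗ₜ g) ⊗ₜ g'))) (E.ψ (c ⊗ₜ a)) := hφ _ _
    _ = pairTensor (pairTensor j i) i ((f ⊗ₜ g) ⊗ₜ g') (E.ψ.rTensor C
          ((TensorProduct.assoc R C A C).symm (E.ψ.lTensor C
            (TensorProduct.assoc R C C A (CoalgebraStruct.comul c ⊗ₜ a))))) := by
      rw [pairTensor_lTensor j hi.mul'_apply, E.ψ_comul, pairTensor_assoc]
    _ = pairTensor (pairTensor i i) j ((TensorProduct.assoc R B B D).symm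
          (φ.lTensor B (TensorProduct.assoc R B D B (φ (f ⊗ₜ g) ⊗ₜ g'))))
          (CoalgebraStruct.comul c ⊗ₜ a) := by
      rw [← pairTensor_assoc i i j, LinearEquiv.apply_symm_apply, pairTensor_lTensor i hφ,
        ← (TensorProduct.assoc R C A C).apply_symm_apply (E.ψ.lTensor C _),
        pairTensor_assoc i j i, ← pairTensor_rTensor hφ, LinearMap.rTensor_tmul,
        LinearEquiv.apply_symm_apply]
    _ = _ := (pairTensor_rTensor hi.mul'_apply j _ (c ⊗ₜ a)).symm

variable [Coalgebra R D]

theorem adjoint_counit (hj : IsDualPairing j.flip) (hi : Function.Injective i)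
    (hφ : ∀ t w, pairTensor i j (φ t) w = pairTensor j i t (E.ψ w)) (f : D) (g : B) :
    TensorProduct.rid R B (CoalgebraStruct.counit.lTensor B (φ (f ⊗ₜ g))) =
      (CoalgebraStruct.counit f : R) • g := by
  have hj_one : j.flip 1 = CoalgebraStruct.counit := LinearMap.ext hj.one_apply
  refine hi (LinearMap.ext fun c => ?_)
  have hc : i (evalRight B (j.flip 1) (φ (f ⊗ₜ g))) c = pairTensor i j (φ (f ⊗ₜ g)) (c ⊗ₜ 1) :=
    (pairTensor_eq i j _ c 1).symm
  rw [hφ, E.ψ_one, pairTensor_tmul, ← j.flip_apply, hj_one] at hc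
  rw [map_smul]
  exact hc

theorem adjoint_comul (hj : IsDualPairing j.flip)
    (hij : Function.Injective (pairTensor (pairTensor i j) j))
    (hφ : ∀ t w, pairTensor i j (φ t) w = pairTensor j i t (E.ψ w)) (f : D) (g : B) :
    CoalgebraStruct.comul.lTensor B (φ (f ⊗ₜ g)) =
      TensorProduct.assoc R B D D (φ.rTensor D ((TensorProduct.assoc R D B D).symm
        (φ.lTensor D (TensorProduct.assoc R D D B (CoalgebraStruct.comul f ⊗ₜ g))))) := by
  have hj_mul (d : D) (s : A ⊗[R] A) :
      pairTensor j j (CoalgebraStruct.comul d) s = j d (LinearMap.mul' R A s) := by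
    rw [← pairTensor_flip, ← hj.mul'_apply, j.flip_apply]
  rw [← LinearEquiv.symm_apply_eq]
  refine hij (TensorProduct.ext_threefold fun c a b => ?_)
  calc pairTensor (pairTensor i j) j ((TensorProduct.assoc R B D D).symm
        (CoalgebraStruct.comul.lTensor B (φ (f ⊗ₜ g)))) (c ⊗ₜ a ⊗ₜ b)
    _ = pairTensor j i (f ⊗ₜ g) (E.ψ (c ⊗ₜ (a * b))) := by
      rw [← pairTensor_assoc, LinearEquiv.apply_symm_apply, pairTensor_lTensor i hj_mul, hφ]
      rfl
    _ = pairTensor (pairTensor j j) i (CoalgebraStruct.comul f ⊗ₜ g)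
          ((TensorProduct.assoc R A A C).symm
            (E.ψ.lTensor A (TensorProduct.assoc R A C A (E.ψ (c ⊗ₜ a) ⊗ₜ b)))) := by
      rw [E.ψ_mul, ← pairTensor_rTensor hj_mul, LinearMap.rTensor_tmul]
    _ = pairTensor (pairTensor i j) j (φ.rTensor D ((TensorProduct.assoc R D B D).symm
          (φ.lTensor D (TensorProduct.assoc R D D B (CoalgebraStruct.comul f ⊗ₜ g)))))
          (c ⊗ₜ a ⊗ₜ b) := by
      rw [pairTensor_rTensor hφ, LinearMap.rTensor_tmul, ← pairTensor_assoc j i j,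
        LinearEquiv.apply_symm_apply, pairTensor_lTensor j hφ, ← pairTensor_assoc j j i,
        LinearEquiv.apply_symm_apply]

/-- The entwining structure `(B, D, φ)` on an algebra `B ⊆ C^*` and a coalgebra `D ⊆ A^*` for which
`φ` is adjoint to the entwining map of `(A, C, ψ)`. -/
def ofAdjoint [IsNoetherianRing R] (hi : IsDualPairing i) (hj : IsDualPairing j.flip)
    (hi_inj : Function.Injective i) (hj_pure : IsPureMap (LinearMap.ltoFun R A R R ∘ₗ j))
    (φ : D ⊗[R] B →ₗ[R] B ⊗[R] D)
    (hφ : ∀ t w, pairTensor i j (φ t) w = pairTensor j i t (E.ψ w)) :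
    EntwiningStructure R B D :=
  have hij := pairTensor_injective i j hi_inj hj_pure
  { ψ := φ
    ψ_mul := E.adjoint_mul hi hij hφ
    ψ_one := E.adjoint_one hi hij hφ
    ψ_comul := E.adjoint_comul hj (pairTensor_injective _ j hij hj_pure) hφ
    ψ_counit := E.adjoint_counit hj hi_inj hφ }

end EntwiningStructure

section FiniteDual

variable {R A C : Type u} [CommRing R] [Ring A] [Algebra R A] [AddCommGroup C] [Module R C]
  [Coalgebra R C]

theorem isDualPairing_dualAlgIncl (A' : Subalgebra R (WithConv (C →ₗ[R] R))) :
    IsDualPairing (dualAlgIncl A') where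
  one_apply _ := rfl
  mul_apply g g' c := by
    refine (LinearMap.convMul_apply g.1 g'.1 c).trans ?_
    induction (CoalgebraStruct.comul c : C ⊗[R] C) with
    | zero => simp
    | tmul x y => rw [pairTensor_tmul]; rfl
    | add s t hs ht => simp only [map_add, hs, ht]

theorem isDualPairing_flip_dualCoalgIncl [IsNoetherianRing R] [IsAlphaAlgebra R A]
    (C' : Subcoalgebra R (FiniteDual R A)) : IsDualPairing (dualCoalgIncl C').flip where
  one_apply _ := rfl
  mul_apply a b f := by
    have h : pairTensor (dualCoalgIncl C') (dualCoalgIncl C') (C'.comul f) =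
        finiteDualPair R A (TensorProduct.map C'.incl C'.incl (C'.comul f)) := by
      rw [dualCoalgIncl, pairTensor, TensorProduct.map_comp]
      rfl
    calc (dualCoalgIncl C').flip (a * b) f
      _ = finiteDualPair R A (finiteDualComul R A (C'.incl f)) (a ⊗ₜ b) :=
        (finiteDualPair_comul R A _ a b).symm
      _ = pairTensor (dualCoalgIncl C') (dualCoalgIncl C') (C'.comul f) (a ⊗ₜ b) := by
        rw [h, C'.map_incl_comul]
        rfl
      _ = _ := (pairTensor_flip _ _ _ _).symm

end FiniteDual

section Entwining

variable {R A C : Type u} [CommRing R] [Ring A] [Algebra R A] [AddCommGroup C] [Module R C]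
  [Coalgebra R C] (E : EntwiningStructure R A C)

section AlphaMap

variable {M N : Type u} [AddCommGroup M] [Module R M] [Module Aᵐᵒᵖ M] [IsScalarTower R Aᵐᵒᵖ M]
  [AddCommGroup N] [Module R N] [Module Aᵐᵒᵖ N] [IsScalarTower R Aᵐᵒᵖ N]

theorem alphaMap_rTensor {p : M →ₗ[R] N} (hp : ∀ (a : A) m, p (op a • m) = op a • p m)
    (t : M ⊗[R] C) (f : SmashOp E) :
    alphaMap E N (p.rTensor C t) f = p (alphaMap E M t f) := by
  induction t with
  | zero => simp
  | tmul m c => simp [hp]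
  | add s t hs ht => simp only [map_add, LinearMap.add_apply, hs, ht]

theorem alphaMap_ofAlg (t : M ⊗[R] C) (a : A) :
    alphaMap E M t (SmashOp.ofAlg E a) =
      op a • TensorProduct.rid R M (CoalgebraStruct.counit.lTensor M t) := by
  induction t with
  | zero => simp
  | tmul m c => simp [SmashOp.ofAlg, smul_comm (op a)]
  | add s t hs ht => simp only [map_add, smul_add, LinearMap.add_apply, hs, ht]

theorem alphaMap_one (t : M ⊗[R] C) :
    alphaMap E M t 1 = TensorProduct.rid R M (CoalgebraStruct.counit.lTensor M t) := by
  rw [← map_one (SmashOp.ofAlg E), alphaMap_ofAlg, op_one, one_smul]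

theorem alphaMap_actOn (m : M) (t : A ⊗[R] C) (f : SmashOp E) :
    alphaMap E M (actOn M m t) f = op (alphaMap E A t f) • m :=
  (alphaMap_rTensor E (p := rightAct R A M ∘ₗ TensorProduct.mk R M A m)
    (fun a b => by simp [mul_smul]) t f).trans (rightAct_tmul R A M m _)

theorem SmashOp.ofAlg_mul_apply (a : A) (f : SmashOp E) (c : C) :
    (SmashOp.ofAlg E a * f).toLin c = alphaMap E A (E.ψ (c ⊗ₜ a)) f := by
  have h (s : C ⊗[R] C) : (SmashOp.ofAlg E a).toLin.lTensor C s =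
      TensorProduct.rid R C (CoalgebraStruct.counit.lTensor C s) ⊗ₜ a := by
    induction s with
    | zero => simp
    | tmul x y => simp [SmashOp.ofAlg, smul_tmul]
    | add s t hs ht => simp only [add_tmul, map_add, hs, ht]
  rw [SmashOp.mul_apply, h, Coalgebra.lTensor_counit_comul, TensorProduct.rid_tmul, one_smul]
  induction E.ψ (c ⊗ₜ a) with
  | zero => simp
  | tmul b d => simp
  | add s t hs ht => simp only [map_add, LinearMap.add_apply, hs, ht]

theorem alphaMap_twist (t : M ⊗[R] C) (a : A) (f : SmashOp E) :
    alphaMap E M (twist E M (t ⊗ₜ a)) f = alphaMap E M t (SmashOp.ofAlg E a * f) := by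
  induction t with
  | zero => simp
  | tmul m c => rw [twist_tmul_tmul, alphaMap_actOn, alphaMap_tmul, SmashOp.ofAlg_mul_apply]
  | add s t hs ht => simp only [add_tmul, map_add, LinearMap.add_apply, hs, ht]

theorem rTensor_counit_inducedCoact (t : M ⊗[R] C) :
    ((TensorProduct.rid R M).toLinearMap ∘ₗ CoalgebraStruct.counit.lTensor M).rTensor C
      (inducedCoact R C M t) = t := by
  induction t with
  | zero => simp
  | add s t hs ht => simp only [map_add, hs, ht]
  | tmul m c =>
    have h (s : C ⊗[R] C) :
        ((TensorProduct.rid R M).toLinearMap ∘ₗ CoalgebraStruct.counit.lTensor M).rTensor C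
          ((TensorProduct.assoc R M C C).symm (m ⊗ₜ s)) =
          m ⊗ₜ TensorProduct.lid R C (CoalgebraStruct.counit.rTensor C s) := by
      induction s with
      | zero => simp
      | tmul x y => simp [smul_tmul]
      | add s t hs ht => simp only [tmul_add, map_add, hs, ht]
    rw [inducedCoact_tmul, h, Coalgebra.rTensor_counit_comul, TensorProduct.lid_tmul, one_smul]

theorem alphaMap_eq_counit_actBy (t : M ⊗[R] C) (f : SmashOp E) :
    alphaMap E M t f = TensorProduct.rid R M (CoalgebraStruct.counit.lTensor M
      ((toInduced E M).symm ((inducedModule E M).actBy f.toLin (toInduced E M t)))) := by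
  let p : InducedCarrier E M →ₗ[R] M := (TensorProduct.rid R M).toLinearMap ∘ₗ
    CoalgebraStruct.counit.lTensor M ∘ₗ (toInduced E M).symm.toLinearMap
  have hp (a : A) (x : InducedCarrier E M) : p (op a • x) = op a • p x := by
    obtain ⟨s, rfl⟩ := (toInduced E M).surjective x
    calc p (op a • toInduced E M s)
      _ = alphaMap E M (twist E M (s ⊗ₜ a)) 1 := (alphaMap_one E _).symm
      _ = op a • p (toInduced E M s) := by rw [alphaMap_twist, mul_one, alphaMap_ofAlg]; rfl
  have ht : p.rTensor C ((inducedModule E M).coact (toInduced E M t)) = t := by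
    rw [inducedModule_coact, ← LinearMap.rTensor_comp_apply]
    exact rTensor_counit_inducedCoact t
  calc alphaMap E M t f
    _ = alphaMap E M (p.rTensor C ((inducedModule E M).coact (toInduced E M t))) f := by rw [ht]
    _ = _ := alphaMap_rTensor E hp _ f

theorem alphaMap_mul (t : M ⊗[R] C) (f g : SmashOp E) :
    alphaMap E M t (f * g) = alphaMap E M
      ((toInduced E M).symm ((inducedModule E M).actBy f.toLin (toInduced E M t))) g := by
  have h := SmashOp.actBy_mul (inducedModule E M) f g (toInduced E M t)
  rw [alphaMap_eq_counit_actBy, alphaMap_eq_counit_actBy]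
  exact congrArg (fun x => TensorProduct.rid R M
    (CoalgebraStruct.counit.lTensor M ((toInduced E M).symm x))) h

end AlphaMap

section AlphaCondition

/-- The element `c ↦ g(c) 1` of `#_ψ^op(C, A)` attached to a functional `g` on `C`. -/
def SmashOp.ofDual (g : Module.Dual R C) : SmashOp E := SmashOp.ofLin E (g.smulRight 1)

theorem alphaMap_ofDual {M : Type u} [AddCommGroup M] [Module R M] [Module Aᵐᵒᵖ M]
    [IsScalarTower R Aᵐᵒᵖ M] (t : M ⊗[R] C) (g : Module.Dual R C) :
    alphaMap E M t (SmashOp.ofDual E g) = evalRight M g t := by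
  induction t with
  | zero => simp
  | tmul m c => simp [SmashOp.ofDual]
  | add s t hs ht => simp only [map_add, LinearMap.add_apply, hs, ht]

theorem alphaCondition_of_isPureMap [IsNoetherianRing R] {W : Type u} {j : C →ₗ[R] (W → R)}
    (hj : IsPureMap j) : E.AlphaCondition := by
  intro M _ _ _ _
  refine (injective_iff_map_eq_zero _).2 fun t ht => hj.eq_zero t fun w => ?_
  rw [← alphaMap_ofDual E, ht, LinearMap.zero_apply]

end AlphaCondition

section SmashCompatible

/-- A right `#_ψ^op(C, A)`-module whose `R`-module and right `A`-module structures are those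
obtained by restriction of scalars. -/
class SmashCompatible (M : Type u) [AddCommGroup M] [Module R M] [Module Aᵐᵒᵖ M]
    [Module (SmashOp E)ᵐᵒᵖ M] : Prop extends IsScalarTower R (SmashOp E)ᵐᵒᵖ M where
  op_smul (a : A) (m : M) : op a • m = op (SmashOp.ofAlg E a) • m

theorem exists_smashCompatible (M : Type u) [AddCommGroup M] [Module (SmashOp E)ᵐᵒᵖ M] :
    ∃ (_ : Module R M) (_ : Module Aᵐᵒᵖ M) (_ : IsScalarTower R Aᵐᵒᵖ M), SmashCompatible E M :=
  let _ := restrictBase E M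
  let _ := restrictAlg E M
  ⟨_, _, restrict_isScalarTower E M,
    { smul_assoc r f m := by rw [Algebra.smul_def, mul_smul]; rfl
      op_smul _ _ := rfl }⟩

/-- The map `M → Hom_R(#_ψ^op(C, A), M)`, `m ↦ [f ↦ m f]`, whose values are compared with those
of `alphaMap` in the definition of `#`-rational modules. -/
def smashOrbit (M : Type u) [AddCommGroup M] [Module R M] [Module (SmashOp E)ᵐᵒᵖ M]
    [IsScalarTower R (SmashOp E)ᵐᵒᵖ M] : M →ₗ[R] SmashOp E →ₗ[R] M :=
  TensorProduct.curry (rightAct R (SmashOp E) M)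

@[simp] theorem smashOrbit_apply {M : Type u} [AddCommGroup M] [Module R M]
    [Module (SmashOp E)ᵐᵒᵖ M] [IsScalarTower R (SmashOp E)ᵐᵒᵖ M] (m : M) (f : SmashOp E) :
    smashOrbit E M m f = op f • m := by
  simp [smashOrbit]

variable {M N : Type u} [AddCommGroup M] [Module R M] [Module Aᵐᵒᵖ M] [Module (SmashOp E)ᵐᵒᵖ M]
  [SmashCompatible E M] [AddCommGroup N] [Module R N] [Module Aᵐᵒᵖ N] [Module (SmashOp E)ᵐᵒᵖ N]
  [SmashCompatible E N]

theorem map_op_smul (p : M →ₗ[(SmashOp E)ᵐᵒᵖ] N) (a : A) (m : M) : p (op a • m) = op a • p m := by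
  rw [SmashCompatible.op_smul (E := E), map_smul, ← SmashCompatible.op_smul]

variable [IsScalarTower R Aᵐᵒᵖ M] [IsScalarTower R Aᵐᵒᵖ N]

theorem mem_ratPart_iff (m : M) :
    m ∈ ratPart E M ↔ smashOrbit E M m ∈ LinearMap.range (alphaMap E M) := by
  have hA := SmashCompatible.op_smul (E := E) (M := M)
  obtain rfl : ‹Module R M› = restrictBase E M :=
    Module.ext' _ _ (algebra_compatible_smul (SmashOp E)ᵐᵒᵖ)
  obtain rfl : ‹Module Aᵐᵒᵖ M› = restrictAlg E M := Module.ext' _ _ fun a m => hA a.unop m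
  simp only [ratPart, Set.mem_ofPred_eq, LinearMap.mem_range, LinearMap.ext_iff, smashOrbit_apply]

theorem alphaMap_rTensor_restrictScalars (p : M →ₗ[(SmashOp E)ᵐᵒᵖ] N) {t : M ⊗[R] C} {m : M}
    (ht : alphaMap E M t = smashOrbit E M m) :
    alphaMap E N ((p.restrictScalars R).rTensor C t) = smashOrbit E N (p m) := by
  ext f
  rw [alphaMap_rTensor E (map_op_smul E p), ht]
  simp

end SmashCompatible

section Rational

instance (M : EntwinedModule E) : SmashCompatible E M where
  smul_assoc r f m := map_smul (alphaMap E M (M.coact m)) r f.unop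
  op_smul a m := by
    refine Eq.trans ?_ (alphaMap_ofAlg E (M.coact m) a).symm
    rw [M.coact_counit]

theorem alphaMap_coact (M : EntwinedModule E) (m : M) :
    alphaMap E M (M.coact m) = smashOrbit E M m :=
  LinearMap.ext fun f => (smashOrbit_apply E m f).symm

theorem isRational_toSmashModules (M : EntwinedModule E) :
    IsRational E ((toSmashModules E).obj M) :=
  Set.eq_univ_of_forall fun m =>
    (mem_ratPart_iff E (M := M) m).2 ⟨M.coact m, alphaMap_coact E M m⟩

theorem assoc_inducedCoact {M : Type u} [AddCommGroup M] [Module R M] (t : M ⊗[R] C) :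
    TensorProduct.assoc R M C C (inducedCoact R C M t) = CoalgebraStruct.comul.lTensor M t := by
  simp [inducedCoact]

variable {E}
variable {M : Type u} [AddCommGroup M] [Module R M] [Module Aᵐᵒᵖ M] [IsScalarTower R Aᵐᵒᵖ M]
  [Module (SmashOp E)ᵐᵒᵖ M] [SmashCompatible E M] {ρ : M →ₗ[R] M ⊗[R] C}

theorem counit_of_alphaMap_eq (hρ : ∀ m, alphaMap E M (ρ m) = smashOrbit E M m) (m : M) :
    TensorProduct.rid R M (CoalgebraStruct.counit.lTensor M (ρ m)) = m := by
  rw [← alphaMap_one E, hρ, smashOrbit_apply, op_one, one_smul]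

theorem twist_of_alphaMap_eq (hα : E.AlphaCondition)
    (hρ : ∀ m, alphaMap E M (ρ m) = smashOrbit E M m) (m : M) (a : A) :
    ρ (op a • m) = twist E M (ρ m ⊗ₜ a) := by
  refine hα M (LinearMap.ext fun f => ?_)
  rw [alphaMap_twist, hρ, hρ, smashOrbit_apply, smashOrbit_apply, SmashCompatible.op_smul (E := E),
    op_mul, mul_smul]

theorem rTensor_eq_inducedCoact_of_alphaMap_eq (hα : E.AlphaCondition)
    (hρ : ∀ m, alphaMap E M (ρ m) = smashOrbit E M m) (m : M) :
    ρ.rTensor C (ρ m) = inducedCoact R C M (ρ m) := by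
  let ι := (toInduced E M).toLinearMap
  have hι (a : A) (x : M) : (ι ∘ₗ ρ) (op a • x) = op a • (ι ∘ₗ ρ) x :=
    congrArg ι (twist_of_alphaMap_eq hα hρ x a)
  have hact (f : SmashOp E) :
      ρ (op f • m) = (toInduced E M).symm ((inducedModule E M).actBy f.toLin (ι (ρ m))) := by
    refine hα M (LinearMap.ext fun g => ?_)
    rw [hρ, smashOrbit_apply, ← mul_smul, ← op_mul, ← smashOrbit_apply, ← hρ, alphaMap_mul]
    rfl
  suffices h : ι.rTensor C (ρ.rTensor C (ρ m)) = ι.rTensor C (inducedCoact R C M (ρ m)) from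
    (LinearEquiv.rTensor C (toInduced E M)).injective h
  refine hα (InducedCarrier E M) (LinearMap.ext fun f => ?_)
  calc alphaMap E (InducedCarrier E M) (ι.rTensor C (ρ.rTensor C (ρ m))) f
    _ = ι (ρ (alphaMap E M (ρ m) f)) := by
      rw [← LinearMap.rTensor_comp_apply, alphaMap_rTensor E hι, LinearMap.comp_apply]
    _ = alphaMap E (InducedCarrier E M) (ι.rTensor C (inducedCoact R C M (ρ m))) f := by
      rw [hρ, smashOrbit_apply, hact]
      rfl

/-- The entwined module on a right `#_ψ^op(C, A)`-module all of whose orbit maps `f ↦ m f` are of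
the form `α_M^ψ(ρ(m))`. -/
def entwinedModuleOfAlphaMapEq (hα : E.AlphaCondition)
    (hρ : ∀ m, alphaMap E M (ρ m) = smashOrbit E M m) : EntwinedModule E where
  carrier := M
  coact := ρ
  coact_coassoc m := by
    rw [rTensor_eq_inducedCoact_of_alphaMap_eq hα hρ, assoc_inducedCoact]
  coact_counit := counit_of_alphaMap_eq hρ
  coact_smul := twist_of_alphaMap_eq hα hρ

theorem exists_entwinedModule (hα : E.AlphaCondition) (N : ModuleCat.{u} (SmashOp E)ᵐᵒᵖ)
    (hN : IsRational E N) : ∃ M : EntwinedModule E, (toSmashModules E).obj M = N := by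
  obtain ⟨_, _, _, _⟩ := exists_smashCompatible E N
  have hrat (m : N) : smashOrbit E N m ∈ LinearMap.range (alphaMap E N) :=
    (mem_ratPart_iff E m).1 (hN ▸ Set.mem_univ m)
  let M := entwinedModuleOfAlphaMapEq hα (factorThrough_spec (alphaMap E N) (hα N) _ hrat)
  have hM : smashModule E M = (inferInstance : Module (SmashOp E)ᵐᵒᵖ N) :=
    Module.ext' _ _ fun f m => (LinearMap.congr_fun
      (factorThrough_spec _ (hα N) _ hrat m) f.unop).trans (smashOrbit_apply E (M := N) m f.unop)
  exact ⟨M, congrArg (fun i => @ModuleCat.of _ _ N _ i) hM⟩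

theorem toSmashModules_injective (hα : E.AlphaCondition) :
    Function.Injective (toSmashModules E).obj := by
  intro M N h
  have hMr := algebra_compatible_smul (R := R) (SmashOp E)ᵐᵒᵖ (M := M)
  have hNr := algebra_compatible_smul (R := R) (SmashOp E)ᵐᵒᵖ (M := N)
  have hMa := SmashCompatible.op_smul (E := E) (M := M)
  have hNa := SmashCompatible.op_smul (E := E) (M := N)
  obtain @⟨M, _, i, j, _, ρ, _, _, _⟩ := M
  obtain @⟨N, _, i', j', _, ρ', _, _, _⟩ := N
  injection h with h_carrier h_add h_smul
  subst h_carrier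
  obtain rfl := eq_of_heq h_add
  have hact (f : (SmashOp E)ᵐᵒᵖ) (m : M) : _ = _ :=
    congrArg (fun i : Module (SmashOp E)ᵐᵒᵖ M => i.smul f m) (eq_of_heq h_smul)
  obtain rfl : i = i' := Module.ext' _ _ fun r m =>
    (hMr r m).trans ((hact _ m).trans (hNr r m).symm)
  obtain rfl : j = j' := Module.ext' _ _ fun a m =>
    (hMa a.unop m).trans ((hact _ m).trans (hNa a.unop m).symm)
  obtain rfl : ρ = ρ' := LinearMap.ext fun m => hα M (LinearMap.ext fun f => hact (op f) m)
  rfl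

theorem full_toSmashModules (hα : E.AlphaCondition) : (toSmashModules E).Full where
  map_surjective {M N} p := by
    let q : M →ₗ[(SmashOp E)ᵐᵒᵖ] N := p.hom
    refine ⟨⟨q.restrictScalars R, map_op_smul E q, fun m => hα N ?_⟩, rfl⟩
    exact (alphaMap_coact E N _).trans
      (alphaMap_rTensor_restrictScalars E q (alphaMap_coact E M m)).symm

instance faithful_toSmashModules : (toSmashModules E).Faithful where
  map_injective h := EntwinedModule.Hom.ext <| LinearMap.ext fun m =>
    congrArg (fun p => p.hom m) h

theorem isIsoOfCategories_lift_toSmashModules (hα : E.AlphaCondition) :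
    IsIsoOfCategories ((IsRational E).lift (toSmashModules E) (isRational_toSmashModules E)) :=
  have := full_toSmashModules hα
  have : ((IsRational E).lift (toSmashModules E) (isRational_toSmashModules E)).IsIso :=
    { bijective_obj := by
        refine ⟨fun M N h => ?_, fun N => ?_⟩
        · exact toSmashModules_injective hα (congrArg ObjectProperty.FullSubcategory.obj h)
        · obtain ⟨M, hM⟩ := exists_entwinedModule hα N.obj N.property
          exact ⟨M, ObjectProperty.FullSubcategory.ext hM⟩ }
  isIsoOfCategories_of_isIso _

end Rational

section Subgenerated

section Closure

variable {M N : Type u} [AddCommGroup M] [Module (SmashOp E)ᵐᵒᵖ M]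
  [AddCommGroup N] [Module (SmashOp E)ᵐᵒᵖ N]

theorem zero_mem_ratPart : (0 : M) ∈ ratPart E M := by
  obtain ⟨_, _, _, _⟩ := exists_smashCompatible E M
  rw [mem_ratPart_iff, map_zero]
  exact zero_mem _

theorem add_mem_ratPart {m n : M} (hm : m ∈ ratPart E M) (hn : n ∈ ratPart E M) :
    m + n ∈ ratPart E M := by
  obtain ⟨_, _, _, _⟩ := exists_smashCompatible E M
  rw [mem_ratPart_iff] at hm hn ⊢
  rw [map_add]
  exact add_mem hm hn

theorem map_mem_ratPart (p : M →ₗ[(SmashOp E)ᵐᵒᵖ] N) {m : M} (hm : m ∈ ratPart E M) :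
    p m ∈ ratPart E N := by
  obtain ⟨_, _, _, _⟩ := exists_smashCompatible E M
  obtain ⟨_, _, _, _⟩ := exists_smashCompatible E N
  obtain ⟨t, ht⟩ := (mem_ratPart_iff E m).1 hm
  exact (mem_ratPart_iff E _).2 ⟨_, alphaMap_rTensor_restrictScalars E p ht⟩

variable {E}

theorem mem_ratPart_of_map_mem (hα : E.AlphaCondition) (i : M →ₗ[(SmashOp E)ᵐᵒᵖ] N)
    (hi : Function.Injective i) {m : M} (hm : i m ∈ ratPart E N) : m ∈ ratPart E M := by
  obtain ⟨_, _, _, _⟩ := exists_smashCompatible E M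
  obtain ⟨_, _, _, _⟩ := exists_smashCompatible E N
  let q := i.range.mkQ
  obtain ⟨_, _, _, _⟩ := exists_smashCompatible E (N ⧸ i.range)
  obtain ⟨t, ht⟩ := (mem_ratPart_iff E _).1 hm
  have hqm : q (i m) = 0 := (Submodule.Quotient.mk_eq_zero _).2 (i.mem_range_self m)
  have hqt : (q.restrictScalars R).rTensor C t = 0 :=
    hα _ (by rw [alphaMap_rTensor_restrictScalars E q ht, hqm, map_zero, map_zero])
  have hiq : Function.Exact (i.restrictScalars R) (q.restrictScalars R) := fun n =>
    (Submodule.Quotient.mk_eq_zero _)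
  obtain ⟨s, rfl⟩ := (rTensor_exact C hiq i.range.mkQ_surjective t).1 hqt
  refine (mem_ratPart_iff E m).2 ⟨s, LinearMap.ext fun f => hi ?_⟩
  calc i (alphaMap E M s f)
    _ = smashOrbit E N (i m) f := by
      rw [← ht, alphaMap_rTensor E (map_op_smul E i)]
      rfl
    _ = i (smashOrbit E M m f) := by rw [smashOrbit_apply, smashOrbit_apply, map_smul]

end Closure

variable {E}

theorem IsRational.of_isSubgeneratedBy (hα : E.AlphaCondition)
    {K N : ModuleCat.{u} (SmashOp E)ᵐᵒᵖ} (hK : IsRational E K) (hN : IsSubgeneratedBy K N) :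
    IsRational E N := by
  obtain ⟨G, ⟨ι, p, hp⟩, i, hi⟩ := hN
  have hsum (k : ι →₀ K) : k ∈ ratPart E (ι →₀ K) := by
    induction k using Finsupp.induction_linear with
    | zero => exact zero_mem_ratPart E
    | add f g hf hg => exact add_mem_ratPart E hf hg
    | single j x => exact map_mem_ratPart E (Finsupp.lsingle j) (Set.eq_univ_iff_forall.1 hK x)
  refine Set.eq_univ_of_forall fun n => mem_ratPart_of_map_mem hα i hi ?_
  obtain ⟨k, hk⟩ := hp (i n)
  exact hk ▸ map_mem_ratPart E p (hsum k)

/-- The coaction of an entwined module `M`, as a morphism `M → M ⊗ C`. -/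
def coactHom (M : EntwinedModule E) : M ⟶ inducedModule E M where
  toLinearMap := (toInduced E M).toLinearMap ∘ₗ M.coact
  map_smul a m := congrArg (toInduced E M) (M.coact_smul m a)
  map_coact m := by
    have h : inducedCoact R C M (M.coact m) = M.coact.rTensor C (M.coact m) :=
      (TensorProduct.assoc R M C C).injective
        ((assoc_inducedCoact _).trans (M.coact_coassoc m).symm)
    exact (congrArg ((toInduced E M).toLinearMap.rTensor C) h).trans
      (LinearMap.rTensor_comp_apply C (toInduced E M).toLinearMap M.coact (M.coact m)).symm

variable {M : Type u} [AddCommGroup M] [Module R M] [Module Aᵐᵒᵖ M] [IsScalarTower R Aᵐᵒᵖ M]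

theorem actOn_twist (m : M) (t : A ⊗[R] C) (a : A) :
    actOn M m (twist E A (t ⊗ₜ a)) = twist E M (actOn M m t ⊗ₜ a) := by
  induction t with
  | zero => simp
  | add s t hs ht => simp only [add_tmul, map_add, hs, ht]
  | tmul b c =>
    rw [actOn_tmul, twist_tmul_tmul, twist_tmul_tmul]
    induction E.ψ (c ⊗ₜ a) with
    | zero => simp
    | add s t hs ht => simp only [map_add, hs, ht]
    | tmul z w => simp [mul_smul]

theorem inducedCoact_actOn (m : M) (t : A ⊗[R] C) :
    inducedCoact R C M (actOn M m t) = (actOn M m).rTensor C (inducedCoact R C A t) := by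
  induction t with
  | zero => simp
  | add s t hs ht => simp only [map_add, hs, ht]
  | tmul b c =>
    simp only [actOn_tmul, inducedCoact_tmul]
    induction (CoalgebraStruct.comul c : C ⊗[R] C) with
    | zero => simp
    | add s t hs ht => simp only [tmul_add, map_add, hs, ht]
    | tmul x y => simp

/-- The morphism `A ⊗ C → M ⊗ C`, `a ⊗ c ↦ m a ⊗ c`, attached to an element `m` of a right
`A`-module `M`. -/
def actOnHom (m : M) : inducedModule E A ⟶ inducedModule E M where
  toLinearMap := (toInduced E M).toLinearMap ∘ₗ actOn M m ∘ₗ (toInduced E A).symm.toLinearMap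
  map_smul a t := congrArg (toInduced E M) (actOn_twist m ((toInduced E A).symm t) a)
  map_coact t := by
    obtain ⟨t, rfl⟩ := (toInduced E A).surjective t
    change (inducedModule E M).coact (toInduced E M (actOn M m t)) =
      ((toInduced E M).toLinearMap ∘ₗ actOn M m ∘ₗ (toInduced E A).symm.toLinearMap).rTensor C
        ((toInduced E A).toLinearMap.rTensor C (inducedCoact R C A t))
    rw [inducedModule_coact, inducedCoact_actOn, ← LinearMap.rTensor_comp_apply,
      ← LinearMap.rTensor_comp_apply]
    rfl

variable (E M) in
theorem isGeneratedBy_inducedModule : IsGeneratedBy ((toSmashModules E).obj (inducedModule E A))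
    ((toSmashModules E).obj (inducedModule E M)) := by
  let p := Finsupp.lsum ℕ fun m : M => ((toSmashModules E).map (actOnHom m)).hom
  refine ⟨M, p, LinearMap.range_eq_top.1 (Submodule.eq_top_iff'.2 fun x => ?_)⟩
  obtain ⟨t, rfl⟩ := (toInduced E M).surjective x
  induction t with
  | zero => exact zero_mem p.range
  | add s t hs ht => exact add_mem hs ht
  | tmul m c =>
    refine ⟨Finsupp.single m (toInduced E A (1 ⊗ₜ c)), (Finsupp.lsum_single ..).trans ?_⟩
    change toInduced E M (actOn M m (1 ⊗ₜ c)) = _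
    rw [actOn_tmul, op_one, one_smul]

theorem IsRational.isSubgeneratedBy (hα : E.AlphaCondition)
    {N : ModuleCat.{u} (SmashOp E)ᵐᵒᵖ} (hN : IsRational E N) :
    IsSubgeneratedBy ((toSmashModules E).obj (inducedModule E A)) N := by
  obtain ⟨M, rfl⟩ := exists_entwinedModule hα N hN
  have hM : Function.LeftInverse
      (fun t : M ⊗[R] C => TensorProduct.rid R M (CoalgebraStruct.counit.lTensor M t)) M.coact :=
    M.coact_counit
  exact ⟨_, isGeneratedBy_inducedModule E M, ((toSmashModules E).map (coactHom M)).hom,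
    hM.injective⟩

theorem isRational_eq_isSubgeneratedBy (hα : E.AlphaCondition) :
    IsRational E = IsSubgeneratedBy ((toSmashModules E).obj (inducedModule E A)) :=
  funext fun _ => propext ⟨IsRational.isSubgeneratedBy hα,
    IsRational.of_isSubgeneratedBy hα (isRational_toSmashModules E _)⟩

end Subgenerated

section FiniteProjective

theorem exists_dualBasis (R C : Type*) [CommRing R] [AddCommGroup C] [Module R C]
    [Module.Finite R C] [Module.Projective R C] :
    ∃ (n : ℕ) (e : Fin n → C) (g : Fin n → Module.Dual R C), ∀ c, ∑ i, g i c • e i = c := by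
  obtain ⟨n, p, q, -, -, hpq⟩ := Module.Finite.exists_comp_eq_id_of_projective R C
  refine ⟨n, fun i => p (Pi.single i 1), fun i => LinearMap.proj i ∘ₗ q, fun c => ?_⟩
  calc ∑ i, q c i • p (Pi.single i 1)
    _ = p (∑ i, q c i • Pi.single i 1) := by simp only [map_sum, map_smul]
    _ = p (q c) := by rw [← pi_eq_sum_univ' (q c)]
    _ = c := LinearMap.congr_fun hpq c

theorem SmashOp.ofDual_mul_ofAlg_apply (g : Module.Dual R C) (a : A) (c : C) :
    (SmashOp.ofDual E g * SmashOp.ofAlg E a).toLin c = g c • a := by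
  have h (s : C ⊗[R] C) :
      LinearMap.mul' R A ((SmashOp.ofAlg E a).toLin.lTensor A
        (E.ψ ((SmashOp.ofDual E g).toLin.lTensor C s))) =
      g (TensorProduct.lid R C (CoalgebraStruct.counit.rTensor C s)) • a := by
    induction s with
    | zero => simp
    | tmul x y => simp [SmashOp.ofDual, SmashOp.ofAlg, E.ψ_one, smul_smul, mul_comm]
    | add s t hs ht => simp only [map_add, add_smul, hs, ht]
  rw [SmashOp.mul_apply, h, Coalgebra.rTensor_counit_comul, TensorProduct.lid_tmul, one_smul]

theorem SmashOp.sum_ofDual_mul_ofAlg {n : ℕ} {e : Fin n → C} {g : Fin n → Module.Dual R C}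
    (he : ∀ c, ∑ i, g i c • e i = c) (f : SmashOp E) :
    ∑ i, SmashOp.ofDual E (g i) * SmashOp.ofAlg E (f.toLin (e i)) = f := by
  have hsum (F : Fin n → SmashOp E) (c : C) : (∑ i, F i).toLin c = ∑ i, (F i).toLin c :=
    LinearMap.sum_apply _ _ _
  refine SmashOp.toLin_ext fun c => ?_
  simp only [hsum, ofDual_mul_ofAlg_apply, ← map_smul, ← map_sum, he]

theorem isRational_of_finite_projective [Module.Finite R C] [Module.Projective R C]
    (N : ModuleCat.{u} (SmashOp E)ᵐᵒᵖ) : IsRational E N := by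
  obtain ⟨_, _, _, _⟩ := exists_smashCompatible E N
  obtain ⟨n, e, g, he⟩ := exists_dualBasis R C
  refine Set.eq_univ_of_forall fun m => (mem_ratPart_iff E m).2
    ⟨∑ i, (op (SmashOp.ofDual E (g i)) • m) ⊗ₜ e i, LinearMap.ext fun f => ?_⟩
  calc alphaMap E N (∑ i, (op (SmashOp.ofDual E (g i)) • m) ⊗ₜ e i) f
    _ = ∑ i, op (SmashOp.ofDual E (g i) * SmashOp.ofAlg E (f.toLin (e i))) • m := by
      simp only [map_sum, LinearMap.sum_apply, alphaMap_tmul, SmashCompatible.op_smul (E := E),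
        op_mul, mul_smul]
    _ = smashOrbit E N m f := by
      rw [← Finset.sum_smul, ← Finset.op_sum, SmashOp.sum_ofDual_mul_ofAlg E he, smashOrbit_apply]

variable {E}

theorem isIsoOfCategories_toSmashModules (hα : E.AlphaCondition) [Module.Finite R C]
    [Module.Projective R C] : IsIsoOfCategories (toSmashModules E) :=
  have := full_toSmashModules hα
  have : (toSmashModules E).IsIso :=
    { bijective_obj := ⟨toSmashModules_injective hα,
        fun N => exists_entwinedModule hα N (isRational_of_finite_projective E N)⟩ }
  isIsoOfCategories_of_isIso _

end FiniteProjective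

end Entwining

end

end DualEntwining

theorem mainTheorem1 {R A C : Type u} [CommRing R] [IsNoetherianRing R]
    [Ring A] [Algebra R A] [IsAlphaAlgebra R A]
    [AddCommGroup C] [Module R C] [Coalgebra R C]
    (E : EntwiningStructure R A C)
    (A' : Subalgebra R (WithConv (C →ₗ[R] R)))
    (C' : Subcoalgebra R (FiniteDual R A))
    (h : DualStable E A' C') :
    ∃ E' : EntwiningStructure R (DualAlg A') C', E'.ψ = dualEntwiningMap E A' C' h ∧
      E'.AlphaCondition ∧
      (∃ hrat : ∀ M : EntwinedModule E', IsRational E' ((toSmashModules E').obj M),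
        IsIsoOfCategories ((IsRational E').lift (toSmashModules E') hrat)) ∧
      IsRational E' = IsSubgeneratedBy ((toSmashModules E').obj (inducedModule E' (DualAlg A'))) ∧
      (Module.Finite R C' → Module.Projective R C' →
        IsIsoOfCategories (toSmashModules E')) := by
  have hφ := fun t => LinearMap.congr_fun (pairAC_dualEntwiningMap E A' C' h t)
  let E' := E.ofAdjoint (isDualPairing_dualAlgIncl A') (isDualPairing_flip_dualCoalgIncl C')
    (dualAlgIncl_injective A') (dualCoalgIncl_isPureMap C') (dualEntwiningMap E A' C' h) hφ
  have hα : E'.AlphaCondition := alphaCondition_of_isPureMap E' (dualCoalgIncl_isPureMap C')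
  exact ⟨E', rfl, hα, ⟨isRational_toSmashModules E', isIsoOfCategories_lift_toSmashModules hα⟩,
    isRational_eq_isSubgeneratedBy hα, fun _ _ => isIsoOfCategories_toSmashModules hα⟩
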